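/- **Conventions.** Let $\mathcal F$ be the class of functions $f:[1,\infty)\to[1,\infty)$ such that (i) $f(1)=1$ and $f(x)<x$ for $x>1$; (ii) $f$ is strictly increasing and tends to infinity; (iii) $\lim_{x\to\infty}x^{-q}f(x)=0$ for every $q>0$; (iv) $x\mapsto x/f(x)$ is concave and non-decreasing on $[1,\infty)$; (v) $f(xy)\le f(x)f(y)$ for $x,y\ge1$. Let $X$ be a (real or complex) Banach space with a Schauder basis $(e_n)$ which is bimonotone, i.e. $\|Ex\|\le\|x\|$ for every $x\in X$ and every interval $E$ of integers, where $Ex$ is the coordinate projection of $x$ onto $E$. Write $v<w$ if $p<q$ for all $p\in\operatorname{supp}v$ and $q\in\operatorname{supp}w$; the support of $x\in X$ is taken with respect to $(e_n)$, and that of $x^*\in X^*$ is $\{n:x^*(e_n)\neq0\}$; $\operatorname{ran}v$ is the smallest interval containing $\operatorname{supp}v$. A block sequence is a (finite or infinite) sequence of non-zero finitely supported vectors $x_1<x_2<\cdots$. * $X$ satisfies a lower $f$-estimate if $f(n)^{-1}\sum_{i=1}^n\|x_i\|\le\|\sum_{i=1}^nx_i\|$ for every block sequence $x_1<\dots<x_n$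 in $X$. * An $\ell_{1+}^n$-average with constant $C$ is a vector $x=\sum_{i=1}^nx_i$ of norm $1$, where $x_1<\dots<x_n$ is a block sequence in $X$ and $\|x_i\|\le C/n$ for all $i$. * For $\epsilon>0$ put $\epsilon'=\min\{\epsilon,1\}$, and put $M_f(t)=f^{-1}(36t^2)$. A R.I.S. of length $N$ with constant $1+\epsilon$ (for $f$) is a block sequence $x_1<\dots<x_N$ in $X$ for which there are integers $n_1,\dots,n_N$ such that $x_k$ is an $\ell_{1+}^{n_k}$-average with constant $1+\epsilon$ for each $k$, $n_1\ge 2(1+\epsilon)M_f(N/\epsilon')/(\epsilon' f'(1))$, where $f'(1)$ is the right derivative, and $|\operatorname{ran}(\sum_{i<k}x_i)|\le\frac{\epsilon'}{2}f(n_k)^{1/2}$ for $k=2,\dots,N$. * An $(M,f)$-form is a functional $f(M)^{-1}(x_1^*+\dots+x_M^*)$ with $x_1^*<\dots<x_M^*$ in $X^*$ of norm at most $1$. * Finite sequences $(y_i)_{i=1}^n,(z_i)_{i=1}^n$ are $M$-equivalent, $(y_i)\sim_M(z_i)$, if $M^{-1}\|\sum a_iz_i\|\le\|\sum a_iy_i\|\le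 M\|\sum a_iz_i\|$ for all scalars $a_i$. * A space $V$ is uniformly inhomogeneous if for every $M\ge1$ there is $n\in\mathbb N$ such that for all infinite-dimensional subspaces $Y_1,\dots,Y_{2n}$ of $V$ there are $y_i\in Y_i$ with $\|y_i\|=1$ and $(y_i)_{i=1}^n\not\sim_M(y_i)_{i=n+1}^{2n}$. * $V\in\{X,X^*\}$ is block uniformly inhomogeneous if for every $M\ge1$ there is $n\in\mathbb N$ such that for all subspaces $Y_1,\dots,Y_{2n}$ of $V$ each containing an infinite block sequence (for instance block subspaces, i.e. closed linear spans of infinite block sequences) there are finitely supported $y_i\in Y_i$ with $\|y_i\|=1$, $y_1<\dots<y_n$, $y_{n+1}<\dots<y_{2n}$ and $(y_i)_{i=1}^n\not\sim_M(y_i)_{i=n+1}^{2n}$. **Proposition.** Let $f\in\mathcal F$, let $X$ be a Banach space with a bimonotone basis satisfying a lower $f$-estimate, let $\epsilon_0=1/10$ and let $L$ be an infinite set of non-negative integers. Assume that for every $N\in L$, every integer $n\in[\log N,\exp N]$ (with $\log 0$ read as $0$ if $0 \in L$), every R.I.S. $x_1,\dots,x_n$ in $X$ with constant $1+\epsilon_0$,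 and $x=\sum_{i=1}^nx_i$, $$\|Ex\|\le\sup\{|x^*(Ex)|:\ M\ge2,\ x^*\text{ is an }(M,f)\text{-form}\}$$ for every interval $E$ such that $\|Ex\|\ge1/3$. Then $X$ and $X^*$ are uniformly inhomogeneous, and both are block uniformly inhomogeneous. -/

import Mathlib

open Filter Topology

noncomputable section

namespace BlockUI

/-- The class `𝓕` of functions `f : [1, ∞) → [1, ∞)` (values of `f` outside `[1, ∞)` play no
role; that `f ≥ 1` on `[1, ∞)` follows from the first and the third field). -/
structure IsClassF (f : ℝ → ℝ) : Prop where
  map_one : f 1 = 1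
  lt_self : ∀ x : ℝ, 1 < x → f x < x
  strictMono : StrictMonoOn f (Set.Ici 1)
  tendsto_atTop : Tendsto f atTop atTop
  small : ∀ q : ℝ, 0 < q → Tendsto (fun x : ℝ => x ^ (-q) * f x) atTop (𝓝 0)
  concave : ConcaveOn ℝ (Set.Ici 1) (fun x : ℝ => x / f x)
  mono : MonotoneOn (fun x : ℝ => x / f x) (Set.Ici 1)
  submul : ∀ x y : ℝ, 1 ≤ x → 1 ≤ y → f (x * y) ≤ f x * f y

/-! ### Supports, ranges, block sequences

`c n v` is the `n`-th coordinate of the vector `v`. -/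

section Coord

variable {𝕜 V : Type*} [RCLike 𝕜] [NormedAddCommGroup V] [NormedSpace 𝕜 V]

/-- The support of `v`. -/
def supp (c : ℕ → V → 𝕜) (v : V) : Set ℕ := {n | c n v ≠ 0}

/-- The range of `v`: the smallest interval of integers containing the support. -/
def ran (c : ℕ → V → 𝕜) (v : V) : Set ℕ :=
  {n | ∃ p ∈ supp c v, ∃ q ∈ supp c v, p ≤ n ∧ n ≤ q}

/-- `v < w`: the support of `v` lies to the left of the support of `w`. -/
def Before (c : ℕ → V → 𝕜) (v w : V) : Prop :=
  ∀ p ∈ supp c v, ∀ q ∈ supp c w, p < q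

/-- A finite or infinite block sequence `x₁ < x₂ < ⋯`: non-zero finitely supported vectors with
successive supports. -/
structure IsBlockSeq {ι : Type*} [LT ι] (c : ℕ → V → 𝕜) (x : ι → V) : Prop where
  ne_zero : ∀ i, x i ≠ 0
  finite_supp : ∀ i, (supp c (x i)).Finite
  successive : ∀ i j, i < j → Before c (x i) (x j)

/-- Two finite sequences are `M`-equivalent. -/
def Equivalent (𝕜 : Type*) {V : Type*} [RCLike 𝕜] [NormedAddCommGroup V] [NormedSpace 𝕜 V]
    (M : ℝ) {n : ℕ} (y z : Fin n → V) : Prop :=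
  ∀ a : Fin n → 𝕜,
    ‖∑ i, a i • y i‖ ≤ M * ‖∑ i, a i • z i‖ ∧ ‖∑ i, a i • z i‖ ≤ M * ‖∑ i, a i • y i‖

/-- `V` is uniformly inhomogeneous. The `2n` subspaces are `Y₁, …, Yₙ, Z₁, …, Zₙ`; they are
infinite-dimensional and need not be closed. -/
def UniformlyInhomogeneous (𝕜 V : Type*) [RCLike 𝕜] [NormedAddCommGroup V] [NormedSpace 𝕜 V] :
    Prop :=
  ∀ M : ℝ, 1 ≤ M → ∃ n : ℕ, ∀ Y Z : Fin n → Submodule 𝕜 V,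
    (∀ i, ¬ FiniteDimensional 𝕜 (Y i)) → (∀ i, ¬ FiniteDimensional 𝕜 (Z i)) →
    ∃ y z : Fin n → V,
      (∀ i, y i ∈ Y i ∧ ‖y i‖ = 1) ∧ (∀ i, z i ∈ Z i ∧ ‖z i‖ = 1) ∧
      ¬ Equivalent 𝕜 M y z

/-- `V` is block uniformly inhomogeneous with respect to the coordinates `c`: for subspaces that
contain infinite block sequences (in particular for block subspaces, that is, closed linear spans
of infinite block sequences), the vectors can be chosen with `y₁ < ⋯ < yₙ` and `z₁ < ⋯ < zₙ`. -/
def BlockUniformlyInhomogeneous (c : ℕ → V → 𝕜) : Prop :=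
  ∀ M : ℝ, 1 ≤ M → ∃ n : ℕ, ∀ Y Z : Fin n → Submodule 𝕜 V,
    (∀ i, ∃ u : ℕ → V, IsBlockSeq c u ∧ ∀ k, u k ∈ Y i) →
    (∀ i, ∃ u : ℕ → V, IsBlockSeq c u ∧ ∀ k, u k ∈ Z i) →
    ∃ y z : Fin n → V,
      (∀ i, y i ∈ Y i ∧ ‖y i‖ = 1) ∧ (∀ i, z i ∈ Z i ∧ ‖z i‖ = 1) ∧
      IsBlockSeq c y ∧ IsBlockSeq c z ∧
      ¬ Equivalent 𝕜 M y z

end Coord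

section Basis

variable {𝕜 X : Type*} [RCLike 𝕜] [NormedAddCommGroup X] [NormedSpace 𝕜 X]

/-- Coordinates of vectors of `X` with respect to the basis. -/
def vecCoord (b : SchauderBasis 𝕜 X) : ℕ → X → 𝕜 := fun n x => b.coord n x

/-- Coordinates of functionals: the `n`-th coordinate of `φ` is `φ (eₙ)`, its coefficient on the
`n`-th biorthogonal functional. -/
def dualCoord (b : SchauderBasis 𝕜 X) : ℕ → StrongDual 𝕜 X → 𝕜 := fun n φ => φ (b n)

/-- The projection `x ↦ E x` for the (possibly empty) interval of integers `E = [p, q]`. -/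
def intervalProj (b : SchauderBasis 𝕜 X) (p q : ℕ) : X →L[𝕜] X :=
  GeneralSchauderBasis.proj b (Finset.Icc p q)

/-- The basis is bimonotone: interval projections have norm at most one. -/
def IsBimonotone (b : SchauderBasis 𝕜 X) : Prop :=
  ∀ (p q : ℕ) (x : X), ‖intervalProj b p q x‖ ≤ ‖x‖

/-- `X` satisfies a lower `f`-estimate. -/
def LowerEstimate (b : SchauderBasis 𝕜 X) (f : ℝ → ℝ) : Prop :=
  ∀ (n : ℕ) (x : Fin n → X), IsBlockSeq (vecCoord b) x →
    (f n)⁻¹ * ∑ i, ‖x i‖ ≤ ‖∑ i, x i‖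

/-- `v` is an `ℓ₁₊ⁿ`-average with constant `C`. -/
def IsL1Average (b : SchauderBasis 𝕜 X) (n : ℕ) (C : ℝ) (v : X) : Prop :=
  ‖v‖ = 1 ∧ ∃ x : Fin n → X, IsBlockSeq (vecCoord b) x ∧ (∀ i, ‖x i‖ ≤ C / n) ∧ v = ∑ i, x i

/-- `M_f(t) = f⁻¹(36 t²)`, the inverse being that of the bijection `f : [1, ∞) → [1, ∞)`. -/
def growthInv (f : ℝ → ℝ) (t : ℝ) : ℝ := Function.invFunOn f (Set.Ici 1) (36 * t ^ 2)

/-- `x₁ < ⋯ < x_N` is a rapidly increasing sequence for `f`, of length `N`, with constant `1 + ε`.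
Here `ε' = min ε 1` and `f'(1)` is the right derivative. -/
def IsRIS (b : SchauderBasis 𝕜 X) (f : ℝ → ℝ) (ε : ℝ) {N : ℕ} (x : Fin N → X) : Prop :=
  IsBlockSeq (vecCoord b) x ∧
  ∃ n : Fin N → ℕ,
    (∀ k, IsL1Average b (n k) (1 + ε) (x k)) ∧
    (∀ k : Fin N, (k : ℕ) = 0 →
      2 * (1 + ε) * growthInv f (N / min ε 1) / (min ε 1 * derivWithin f (Set.Ici 1) 1) ≤ n k) ∧
    (∀ k : Fin N, 0 < (k : ℕ) →
      ((ran (vecCoord b) (∑ i with i < k, x i)).ncard : ℝ) ≤ min ε 1 / 2 * Real.sqrt (f (n k)))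

/-- `φ` is an `(M, f)`-form: `φ = f(M)⁻¹ (φ₁ + ⋯ + φ_M)` with `φ₁ < ⋯ < φ_M` of norm at most
one. -/
def IsForm (b : SchauderBasis 𝕜 X) (f : ℝ → ℝ) (M : ℕ) (φ : StrongDual 𝕜 X) : Prop :=
  ∃ ψ : Fin M → StrongDual 𝕜 X, (∀ i, ‖ψ i‖ ≤ 1) ∧
    (∀ i j, i < j → Before (dualCoord b) (ψ i) (ψ j)) ∧
    φ = ((f M : ℝ) : 𝕜)⁻¹ • ∑ i, ψ i

/-- `sup { |φ(v)| : M ≥ 2, φ an (M, f)-form }`. Under a lower `f`-estimate every form has norm at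
most one (for a bimonotone basis), so that the set is bounded. -/
def formNorm (b : SchauderBasis 𝕜 X) (f : ℝ → ℝ) (v : X) : ℝ :=
  sSup {r : ℝ | ∃ (M : ℕ) (φ : StrongDual 𝕜 X), 2 ≤ M ∧ IsForm b f M φ ∧ r = ‖φ v‖}

end Basis

end BlockUI

end

namespace BlockUI

/-! ### Growth functions -/

section ClassF

variable {f : ℝ → ℝ}

theorem IsClassF.monotoneOn (hf : IsClassF f) {x y : ℝ} (hx : 1 ≤ x) (hxy : x ≤ y) : f x ≤ f y :=
  hf.strictMono.monotoneOn hx (hx.trans hxy) hxy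

theorem IsClassF.one_le (hf : IsClassF f) {x : ℝ} (hx : 1 ≤ x) : 1 ≤ f x :=
  hf.map_one ▸ hf.monotoneOn le_rfl hx

theorem IsClassF.pos (hf : IsClassF f) {x : ℝ} (hx : 1 ≤ x) : 0 < f x :=
  zero_lt_one.trans_le (hf.one_le hx)

theorem IsClassF.le_self (hf : IsClassF f) {x : ℝ} (hx : 1 ≤ x) : f x ≤ x := by
  rcases hx.eq_or_lt with rfl | h
  · exact hf.map_one.le
  · exact (hf.lt_self x h).le

/-- `f` grows more slowly than any power: along powers of `n` it is eventually below any
geometric sequence. -/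
theorem IsClassF.exists_pow_lt (hf : IsClassF f) {n : ℕ} (hn : 1 ≤ n) {C : ℝ} (hC : 1 < C) :
    ∃ k : ℕ, f ((n : ℝ) ^ k) < C ^ k := by
  rcases hn.eq_or_lt with rfl | hn
  · exact ⟨1, by simpa [hf.map_one] using hC⟩
  have hn' : (1 : ℝ) < n := by exact_mod_cast hn
  have hlog : 0 < Real.log n := Real.log_pos hn'
  set q : ℝ := Real.log C / Real.log n with hq
  have hq0 : 0 < q := div_pos (Real.log_pos hC) hlog
  have h1 := (hf.small q hq0).comp (tendsto_pow_atTop_atTop_of_one_lt hn')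
  obtain ⟨k, hk⟩ := (h1.eventually (gt_mem_nhds zero_lt_one)).exists
  refine ⟨k, ?_⟩
  have hpos : (0 : ℝ) < (n : ℝ) ^ k := by positivity
  have hpow : ((n : ℝ) ^ k) ^ q = C ^ k := by
    have : (n : ℝ) ^ q = C := by
      rw [Real.rpow_def_of_pos (by linarith), hq, mul_div_cancel₀ _ hlog.ne',
        Real.exp_log (by linarith)]
    rw [← Real.rpow_natCast, ← Real.rpow_mul (by linarith), mul_comm, Real.rpow_mul (by linarith),
      this, Real.rpow_natCast]
  simp only [Function.comp, Real.rpow_neg hpos.le, hpow] at hk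
  rwa [inv_mul_lt_iff₀ (by positivity), mul_one] at hk

/-- The function `x ↦ x / f x`, extended by the identity to `[0, 1]`. -/
noncomputable def ratioFn (f : ℝ → ℝ) (t : ℝ) : ℝ := t / f (max t 1)

theorem IsClassF.ratioFn_of_le (hf : IsClassF f) {t : ℝ} (ht : t ≤ 1) : ratioFn f t = t := by
  simp [ratioFn, max_eq_right ht, hf.map_one]

theorem ratioFn_of_ge {t : ℝ} (ht : 1 ≤ t) : ratioFn f t = t / f t := by
  simp [ratioFn, max_eq_left ht]

theorem IsClassF.ratioFn_one (hf : IsClassF f) : ratioFn f 1 = 1 := hf.ratioFn_of_le le_rfl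

theorem IsClassF.one_le_ratioFn (hf : IsClassF f) {t : ℝ} (ht : 1 ≤ t) : 1 ≤ ratioFn f t := by
  rw [ratioFn_of_ge ht, one_le_div (hf.pos ht)]
  exact hf.le_self ht

theorem IsClassF.ratioFn_mono (hf : IsClassF f) {s t : ℝ} (hst : s ≤ t) :
    ratioFn f s ≤ ratioFn f t := by
  rcases le_total t 1 with ht | ht
  · rwa [hf.ratioFn_of_le ht, hf.ratioFn_of_le (hst.trans ht)]
  rcases le_total s 1 with hs | hs
  · rw [hf.ratioFn_of_le hs]
    exact hs.trans (hf.one_le_ratioFn ht)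
  · rw [ratioFn_of_ge hs, ratioFn_of_ge ht]
    exact hf.mono hs ht hst

theorem IsClassF.ratioFn_le_self (hf : IsClassF f) {t : ℝ} (ht : 0 ≤ t) : ratioFn f t ≤ t :=
  div_le_self ht (hf.one_le (le_max_right _ _))

theorem IsClassF.ratioFn_concave (hf : IsClassF f) :
    ConcaveOn ℝ (Set.Ici 0) (ratioFn f) := by
  have hc : ∀ x y z : ℝ, 1 ≤ x → x < y → y < z →
      (ratioFn f z - ratioFn f y) / (z - y) ≤ (ratioFn f y - ratioFn f x) / (y - x) := by
    intro x y z hx hxy hyz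
    rw [ratioFn_of_ge hx, ratioFn_of_ge (hx.trans hxy.le),
      ratioFn_of_ge (hx.trans (hxy.trans hyz).le)]
    exact hf.concave.slope_anti_adjacent hx (hx.trans (hxy.trans hyz).le) hxy hyz
  have hle : ∀ z : ℝ, 1 ≤ z → ratioFn f z ≤ z := fun z hz =>
    hf.ratioFn_le_self (zero_le_one.trans hz)
  refine concaveOn_of_slope_anti_adjacent (convex_Ici 0) ?_
  intro x y z hx hz hxy hyz
  rcases le_total 1 x with h1x | hx1
  · exact hc x y z h1x hxy hyz
  rw [hf.ratioFn_of_le hx1]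
  rcases le_total y 1 with hy1 | h1y
  · rw [hf.ratioFn_of_le hy1, div_self (by linarith), div_le_one (by linarith)]
    rcases le_total z 1 with hz1 | h1z
    · rw [hf.ratioFn_of_le hz1]
    · linarith [hle z h1z]
  · rcases h1y.eq_or_lt with rfl | h1y
    · rw [hf.ratioFn_one, div_self (by linarith), div_le_one (by linarith)]
      linarith [hle z hyz.le]
    · refine (hc 1 y z le_rfl h1y hyz).trans ?_
      rw [hf.ratioFn_one, div_le_div_iff₀ (by linarith) (by linarith)]
      nlinarith [hle y h1y.le]

/-- The estimate for cutting into `m` pieces: the sum of the ratios of the pieces is at most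
`f m` times the ratio of the whole. -/
theorem IsClassF.sum_ratioFn_le (hf : IsClassF f) {ι : Type*} (s : Finset ι) (hs : s.Nonempty)
    (l : ι → ℝ) (hl : ∀ i ∈ s, 0 ≤ l i) {t : ℝ} (ht : 1 ≤ t) (hsum : ∑ i ∈ s, l i ≤ t) :
    ∑ i ∈ s, ratioFn f (l i) ≤ f s.card * ratioFn f t := by
  have hm : (1 : ℝ) ≤ s.card := by exact_mod_cast hs.card_pos
  have hm0 : (0 : ℝ) < s.card := by linarith
  have hfm := hf.pos hm
  have hft := hf.pos ht
  rw [ratioFn_of_ge ht]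
  rcases le_total t s.card with h | h
  · calc ∑ i ∈ s, ratioFn f (l i) ≤ ∑ i ∈ s, l i :=
        Finset.sum_le_sum fun i hi => hf.ratioFn_le_self (hl i hi)
      _ ≤ t := hsum
      _ = f t * (t / f t) := by field_simp
      _ ≤ f s.card * (t / f t) := by
        gcongr
        exact hf.monotoneOn ht h
  · have hJ := hf.ratioFn_concave.le_map_sum (t := s) (w := fun _ => (s.card : ℝ)⁻¹) (p := l)
      (fun _ _ => by positivity) (by simp [hm0.ne']) hl
    simp only [smul_eq_mul, ← Finset.mul_sum] at hJ
    have h1 : ∑ i ∈ s, ratioFn f (l i) ≤ s.card * ratioFn f (t / s.card) := by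
      rw [← inv_mul_le_iff₀ hm0]
      refine hJ.trans (hf.ratioFn_mono ?_)
      rw [div_eq_inv_mul]
      gcongr
    have h2 : 1 ≤ t / s.card := (one_le_div hm0).2 h
    refine h1.trans ?_
    rw [ratioFn_of_ge h2]
    have h3 : f t ≤ f s.card * f (t / s.card) := by
      have := hf.submul s.card (t / s.card) hm h2
      rwa [mul_div_cancel₀ _ hm0.ne'] at this
    have h4 := hf.pos h2
    rw [show (s.card : ℝ) * (t / s.card / f (t / s.card)) = t / f (t / s.card) by field_simp,
      ← mul_div_assoc, div_le_div_iff₀ h4 hft]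
    nlinarith

end ClassF

/-! ### Interval projections -/

section Projections

variable {𝕜 X : Type*} [RCLike 𝕜] [NormedAddCommGroup X] [NormedSpace 𝕜 X]
variable (b : SchauderBasis 𝕜 X)

/-- The coordinate projection onto the half-open interval `[a, c)`. -/
noncomputable def icoProj (a c : ℕ) : X →L[𝕜] X :=
  GeneralSchauderBasis.proj b (Finset.Ico a c)

theorem icoProj_apply (a c : ℕ) (x : X) :
    icoProj b a c x = ∑ i ∈ Finset.Ico a c, b.coord i x • b i :=
  GeneralSchauderBasis.proj_apply _ _ _

theorem coord_basis (i j : ℕ) : b.coord i (b j) = if i = j then 1 else 0 := by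
  rw [b.ortho]
  by_cases h : i = j
  · subst h
    simp
  · simp [h]

theorem coord_icoProj (n a c : ℕ) (x : X) :
    b.coord n (icoProj b a c x) = if a ≤ n ∧ n < c then b.coord n x else 0 := by
  simp [icoProj_apply, coord_basis]

theorem icoProj_eq_intervalProj (p q : ℕ) : icoProj b p (q + 1) = intervalProj b p q := by
  rw [icoProj, intervalProj]
  congr 1

theorem icoProj_of_le {a c : ℕ} (h : c ≤ a) : icoProj b a c = 0 := by
  rw [icoProj, Finset.Ico_eq_empty_of_le h, GeneralSchauderBasis.proj_empty]

theorem icoProj_icoProj (a c a' c' : ℕ) (x : X) :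
    icoProj b a c (icoProj b a' c' x) = icoProj b (max a a') (min c c') x := by
  rw [icoProj, icoProj, icoProj, GeneralSchauderBasis.proj_comp]
  congr 2
  ext n
  simp only [Finset.mem_inter, Finset.mem_Ico]
  omega

theorem icoProj_add_icoProj {a m c : ℕ} (h : a ≤ m) (h' : m ≤ c) (x : X) :
    icoProj b a m x + icoProj b m c x = icoProj b a c x := by
  simp only [icoProj_apply]
  exact Finset.sum_Ico_consecutive _ h h'

theorem sum_icoProj {c : ℕ → ℕ} (hc : Monotone c) (n : ℕ) (x : X) :
    ∑ k ∈ Finset.range n, icoProj b (c k) (c (k + 1)) x = icoProj b (c 0) (c n) x := by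
  induction n with
  | zero => simp [icoProj_of_le]
  | succ n ih =>
    rw [Finset.sum_range_succ, ih, icoProj_add_icoProj b (hc (Nat.zero_le _)) (hc (Nat.le_succ _))]

variable {b}

theorem IsBimonotone.norm_icoProj_le (hb : IsBimonotone b) (a c : ℕ) (x : X) :
    ‖icoProj b a c x‖ ≤ ‖x‖ := by
  rcases le_or_gt c a with h | h
  · simp [icoProj_of_le b h]
  · obtain ⟨q, rfl⟩ : ∃ q, c = q + 1 := ⟨c - 1, by omega⟩
    rw [icoProj_eq_intervalProj]
    exact hb a q x

variable (b)

theorem tendsto_icoProj (x : X) : Tendsto (fun q => icoProj b 0 q x) atTop (𝓝 x) := by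
  have := SchauderBasis.tendsto_proj b x
  simp only [SchauderBasis.proj, Finset.range_eq_Ico] at this
  exact this

variable {b}

theorem eq_of_coord_eq {x y : X} (h : ∀ n, b.coord n x = b.coord n y) : x = y := by
  refine tendsto_nhds_unique ((tendsto_icoProj b x).congr fun q => ?_) (tendsto_icoProj b y)
  simp only [icoProj_apply, h]

theorem icoProj_eq_self_iff {b : SchauderBasis 𝕜 X} {a c : ℕ} {x : X} :
    icoProj b a c x = x ↔ supp (vecCoord b) x ⊆ Set.Ico a c := by
  constructor
  · intro h n hn
    by_contra hcon
    apply hn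
    show b.coord n x = 0
    rw [← h, coord_icoProj, if_neg]
    simpa using hcon
  · intro h
    refine eq_of_coord_eq (b := b) fun n => ?_
    rw [coord_icoProj]
    split_ifs with hn
    · rfl
    · by_contra hcon
      exact hn (h (show n ∈ supp (vecCoord b) x from Ne.symm hcon))

theorem supp_icoProj_subset (a c : ℕ) (x : X) :
    supp (vecCoord b) (icoProj b a c x) ⊆ Set.Ico a c ∩ supp (vecCoord b) x := by
  intro n hn
  have hn' : b.coord n (icoProj b a c x) ≠ 0 := hn
  rw [coord_icoProj] at hn'
  split_ifs at hn' with h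
  · exact ⟨h, hn'⟩
  · exact absurd rfl hn'

theorem finite_supp_icoProj (a c : ℕ) (x : X) : (supp (vecCoord b) (icoProj b a c x)).Finite :=
  (Set.finite_Ico a c).subset fun _ hn => (supp_icoProj_subset a c x hn).1

theorem exists_supp_subset {V : Type*} {c : ℕ → V → 𝕜} {v : V} (h : (supp c v).Finite) (p : ℕ) :
    ∃ q, p ≤ q ∧ ∀ n ∈ supp c v, n < q := by
  obtain ⟨B, hB⟩ := h.bddAbove
  exact ⟨max p (B + 1), le_max_left _ _, fun n hn =>
    (Nat.lt_succ_of_le (hB hn)).trans_le (le_max_right _ _)⟩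

/-! ### The dual side -/

theorem dual_ext {φ ψ : StrongDual 𝕜 X} (h : ∀ n, φ (b n) = ψ (b n)) : φ = ψ := by
  ext x
  refine tendsto_nhds_unique (((φ.continuous.tendsto x).comp (tendsto_icoProj b x)).congr
    fun q => ?_) ((ψ.continuous.tendsto x).comp (tendsto_icoProj b x))
  simp [icoProj_apply, h]

variable (b)

/-- The projection of a functional onto the half-open interval `[a, c)`. -/
noncomputable def dualProj (a c : ℕ) : StrongDual 𝕜 X →L[𝕜] StrongDual 𝕜 X :=
  (ContinuousLinearMap.compL 𝕜 X X 𝕜).flip (icoProj b a c)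

theorem dualProj_apply (a c : ℕ) (φ : StrongDual 𝕜 X) (x : X) :
    dualProj b a c φ x = φ (icoProj b a c x) := rfl

theorem dualCoord_dualProj (n a c : ℕ) (φ : StrongDual 𝕜 X) :
    dualCoord b n (dualProj b a c φ) = if a ≤ n ∧ n < c then dualCoord b n φ else 0 := by
  show φ (icoProj b a c (b n)) = if _ then φ (b n) else 0
  simp [icoProj_apply, coord_basis, apply_ite φ]

variable {b}

theorem IsBimonotone.norm_dualProj_le (hb : IsBimonotone b) (a c : ℕ) (φ : StrongDual 𝕜 X) :
    ‖dualProj b a c φ‖ ≤ ‖φ‖ :=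
  ContinuousLinearMap.opNorm_le_bound _ (norm_nonneg _) fun x =>
    (φ.le_opNorm _).trans (by gcongr; exact hb.norm_icoProj_le a c x)

theorem dualProj_eq_self_iff {a c : ℕ} {φ : StrongDual 𝕜 X} :
    dualProj b a c φ = φ ↔ supp (dualCoord b) φ ⊆ Set.Ico a c := by
  constructor
  · intro h n hn
    by_contra hcon
    apply hn
    show dualCoord b n φ = 0
    rw [← h, dualCoord_dualProj, if_neg]
    simpa using hcon
  · intro h
    refine dual_ext (b := b) fun n => ?_
    have := dualCoord_dualProj b n a c φ
    rw [show dualProj b a c φ (b n) = dualCoord b n (dualProj b a c φ) from rfl, this]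
    split_ifs with hn
    · rfl
    · by_contra hcon
      exact hn (h (show n ∈ supp (dualCoord b) φ from Ne.symm hcon))

end Projections


section Estimates

variable {𝕜 X : Type*} [RCLike 𝕜] [NormedAddCommGroup X] [NormedSpace 𝕜 X]
variable {b : SchauderBasis 𝕜 X} {f : ℝ → ℝ}

theorem sum_orderEmbOfFin {ι E : Type*} [LinearOrder ι] [AddCommMonoid E] (s : Finset ι) {k : ℕ}
    (h : s.card = k) (g : ι → E) : ∑ i : Fin k, g (s.orderEmbOfFin h i) = ∑ i ∈ s, g i := by
  conv_rhs => rw [← Finset.map_orderEmbOfFin_univ s h, Finset.sum_map]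
  rfl

theorem coord_ne_zero_of_sum {ι : Type*} {s : Finset ι} {x : ι → X} {n : ℕ}
    (h : n ∈ supp (vecCoord b) (∑ i ∈ s, x i)) : ∃ i ∈ s, n ∈ supp (vecCoord b) (x i) := by
  by_contra! hcon
  apply h
  show b.coord n (∑ i ∈ s, x i) = 0
  rw [map_sum]
  exact Finset.sum_eq_zero fun i hi => not_not.1 (hcon i hi)

/-- The lower estimate for successive vectors some of which may vanish. -/
theorem LowerEstimate.sum_norm_le (hlow : LowerEstimate b f) (hf : IsClassF f) {ι : Type*}
    [LinearOrder ι] {s : Finset ι} (hs : s.Nonempty) {x : ι → X}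
    (hfin : ∀ i ∈ s, (supp (vecCoord b) (x i)).Finite)
    (hsucc : ∀ i ∈ s, ∀ j ∈ s, i < j → Before (vecCoord b) (x i) (x j)) :
    ∑ i ∈ s, ‖x i‖ ≤ f s.card * ‖∑ i ∈ s, x i‖ := by
  classical
  have hpos := hf.pos (x := s.card) (by exact_mod_cast hs.card_pos)
  set t := s.filter fun i => x i ≠ 0 with ht
  have hts : t ⊆ s := Finset.filter_subset _ _
  have h0 : ∀ i ∈ s, i ∉ t → x i = 0 := fun i hi hit => by simpa [ht, hi] using hit
  rw [← Finset.sum_subset hts fun i hi hit => by simp [h0 i hi hit],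
    ← Finset.sum_subset hts h0]
  rcases t.eq_empty_or_nonempty with he | hne
  · simp [he]
  have hk : (1 : ℝ) ≤ t.card := by exact_mod_cast hne.card_pos
  have hmem := fun i => t.orderEmbOfFin_mem rfl i
  have hblock : IsBlockSeq (vecCoord b) fun i => x (t.orderEmbOfFin rfl i) :=
    ⟨fun i => (Finset.mem_filter.1 (hmem i)).2, fun i => hfin _ (hts (hmem i)),
      fun i j hij => hsucc _ (hts (hmem i)) _ (hts (hmem j)) (by simpa using hij)⟩
  have := hlow t.card _ hblock
  rw [sum_orderEmbOfFin t rfl fun i => ‖x i‖, sum_orderEmbOfFin t rfl x,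
    inv_mul_le_iff₀ (hf.pos hk)] at this
  refine this.trans ?_
  gcongr
  exact hf.monotoneOn hk (by exact_mod_cast Finset.card_le_card hts)

/-- The lower estimate for the pieces of a vector cut along `c 0 ≤ c 1 ≤ ⋯ ≤ c M`. -/
theorem LowerEstimate.sum_norm_icoProj_le (hlow : LowerEstimate b f) (hf : IsClassF f)
    (hb : IsBimonotone b) {c : ℕ → ℕ} (hc : Monotone c) {M : ℕ} (hM : 1 ≤ M) (v : X) :
    ∑ k ∈ Finset.range M, ‖icoProj b (c k) (c (k + 1)) v‖ ≤ f M * ‖v‖ := by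
  have h := hlow.sum_norm_le hf (s := Finset.range M) ⟨0, by simp; omega⟩
    (x := fun k => icoProj b (c k) (c (k + 1)) v) (fun _ _ => finite_supp_icoProj _ _ _) (by
      intro i _ j _ hij p hp q hq
      have h1 := (supp_icoProj_subset _ _ _ hp).1
      have h2 := (supp_icoProj_subset _ _ _ hq).1
      exact h1.2.trans_le ((hc hij).trans h2.1))
  rw [sum_icoProj b hc, Finset.card_range] at h
  refine h.trans ?_
  have := hf.pos (x := M) (by exact_mod_cast hM)
  gcongr
  exact hb.norm_icoProj_le _ _ _

/-- Successive functionals act on a finite interval through the pieces of a partition of it into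
intervals. -/
theorem exists_cuts {M : ℕ} {ψ : Fin M → StrongDual 𝕜 X}
    (hψ : ∀ i j, i < j → Before (dualCoord b) (ψ i) (ψ j)) {p q : ℕ} (hpq : p ≤ q) :
    ∃ c : ℕ → ℕ, Monotone c ∧ (∀ k, p ≤ c k ∧ c k ≤ q) ∧
      ∀ (k : Fin M) (v : X), ψ k (icoProj b p q v) = ψ k (icoProj b (c k) (c (k + 1)) v) := by
  set S : ℕ → Set ℕ := fun k =>
    {n | (p ≤ n ∧ n < q) ∧ ∃ l : Fin M, k ≤ l ∧ ψ l (b n) ≠ 0} ∪ {q} with hS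
  have hqS : ∀ k, q ∈ S k := fun k => Or.inr rfl
  have hmem : ∀ k, sInf (S k) ∈ S k := fun k => Nat.sInf_mem ⟨q, hqS k⟩
  have hbd : ∀ k, p ≤ sInf (S k) ∧ sInf (S k) ≤ q := fun k => by
    rcases hmem k with h | h
    · exact ⟨h.1.1, h.1.2.le⟩
    · rw [Set.mem_singleton_iff.1 h]
      exact ⟨hpq, le_rfl⟩
  refine ⟨fun k => sInf (S k), ?_, hbd, ?_⟩
  · intro k l hkl
    apply Nat.sInf_le
    rcases hmem l with ⟨h1, i, h2, h3⟩ | h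
    · exact Or.inl ⟨h1, i, hkl.trans h2, h3⟩
    · exact Or.inr h
  · intro k v
    simp only [icoProj_apply, map_sum]
    symm
    apply Finset.sum_subset (Finset.Ico_subset_Ico (hbd _).1 (hbd _).2)
    intro n hn hn'
    rw [Finset.mem_Ico] at hn
    suffices h : ψ k (b n) = 0 by simp [h]
    by_contra hne
    have h1 : sInf (S k) ≤ n := Nat.sInf_le (Or.inl ⟨hn, k, le_rfl, hne⟩)
    have h2 : sInf (S (k + 1)) ≤ n := by
      by_contra h
      exact hn' (Finset.mem_Ico.2 ⟨h1, not_le.1 h⟩)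
    rcases hmem (k + 1) with ⟨-, l, hl, hl'⟩ | h
    · exact absurd (hψ k l (Fin.lt_def.2 hl) n hne _ hl') (not_lt.2 h2)
    · rw [Set.mem_singleton_iff.1 h] at h2
      omega

/-- Successive functionals satisfy an upper `f`-estimate. -/
theorem LowerEstimate.norm_sum_dual_le (hlow : LowerEstimate b f) (hf : IsClassF f)
    (hb : IsBimonotone b) {ι : Type*} [LinearOrder ι] {s : Finset ι} (hs : s.Nonempty)
    {φ : ι → StrongDual 𝕜 X} {B : ℝ} (hB : ∀ i ∈ s, ‖φ i‖ ≤ B)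
    (hsucc : ∀ i ∈ s, ∀ j ∈ s, i < j → Before (dualCoord b) (φ i) (φ j)) :
    ‖∑ i ∈ s, φ i‖ ≤ f s.card * B := by
  have hcard : (1 : ℝ) ≤ s.card := by exact_mod_cast hs.card_pos
  have hpos := hf.pos hcard
  have hB0 : 0 ≤ B := (norm_nonneg _).trans (hB _ hs.choose_spec)
  refine ContinuousLinearMap.opNorm_le_bound _ (by positivity) fun v => ?_
  refine le_of_tendsto ((((∑ i ∈ s, φ i).continuous.tendsto v).comp (tendsto_icoProj b v)).norm)
    (Eventually.of_forall fun q => ?_)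
  have hmem := fun i => s.orderEmbOfFin_mem rfl i
  obtain ⟨c, hc, -, hcψ⟩ := exists_cuts (b := b) (ψ := fun i => φ (s.orderEmbOfFin rfl i))
    (fun i j hij => hsucc _ (hmem i) _ (hmem j) (by simpa using hij)) (Nat.zero_le q)
  simp only [Function.comp]
  rw [← sum_orderEmbOfFin s rfl φ, sum_apply]
  calc ‖∑ i, φ (s.orderEmbOfFin rfl i) (icoProj b 0 q v)‖
      ≤ ∑ i : Fin s.card, B * ‖icoProj b (c i) (c (i + 1)) v‖ := by
        refine norm_sum_le_of_le _ fun i _ => ?_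
        rw [hcψ]
        exact (ContinuousLinearMap.le_opNorm _ _).trans (by gcongr; exact hB _ (hmem i))
    _ = B * ∑ k ∈ Finset.range s.card, ‖icoProj b (c k) (c (k + 1)) v‖ := by
        rw [← Finset.mul_sum,
          Fin.sum_univ_eq_sum_range (fun k => ‖icoProj b (c k) (c (k + 1)) v‖)]
    _ ≤ B * (f s.card * ‖v‖) := by
        gcongr
        exact hlow.sum_norm_icoProj_le hf hb hc (by exact_mod_cast hcard) v
    _ = f s.card * B * ‖v‖ := by ring

/-- The value of a form on an interval is controlled by the pieces of a partition. -/
theorem IsForm.exists_cuts (hf : IsClassF f) {M : ℕ} (hM : 1 ≤ M) {φ : StrongDual 𝕜 X}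
    (hφ : IsForm b f M φ) {p q : ℕ} (hpq : p ≤ q) (v : X) :
    ∃ c : ℕ → ℕ, Monotone c ∧ (∀ k, p ≤ c k ∧ c k ≤ q) ∧
      f M * ‖φ (icoProj b p q v)‖ ≤ ∑ k ∈ Finset.range M, ‖icoProj b (c k) (c (k + 1)) v‖ := by
  obtain ⟨ψ, hψ1, hψ2, rfl⟩ := hφ
  obtain ⟨c, hc, hc', hcψ⟩ := BlockUI.exists_cuts (b := b) hψ2 hpq
  refine ⟨c, hc, hc', ?_⟩
  have hpos := hf.pos (x := M) (by exact_mod_cast hM)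
  rw [smul_apply, norm_smul, norm_inv, RCLike.norm_ofReal, abs_of_pos hpos,
    mul_inv_cancel_left₀ hpos.ne', sum_apply,
    ← Fin.sum_univ_eq_sum_range (fun k => ‖icoProj b (c k) (c (k + 1)) v‖)]
  refine norm_sum_le_of_le _ fun i _ => ?_
  rw [hcψ]
  refine (ContinuousLinearMap.le_opNorm _ _).trans ?_
  exact mul_le_of_le_one_left (norm_nonneg _) (hψ1 i)

end Estimates


section Weights

variable {𝕜 X : Type*} [RCLike 𝕜] [NormedAddCommGroup X] [NormedSpace 𝕜 X]
variable (b : SchauderBasis 𝕜 X)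

/-- The left end of the support of a vector. -/
noncomputable def leftEnd (v : X) : ℕ := sInf (supp (vecCoord b) v)

/-- The total weight of those vectors of a family whose support starts in `[p, q)`. -/
noncomputable def weight {ι : Type*} [Fintype ι] (v : ι → X) (w : ι → ℝ) (p q : ℕ) : ℝ :=
  ∑ i, if p ≤ leftEnd b (v i) ∧ leftEnd b (v i) < q then w i else 0

variable {b}

theorem supp_nonempty {v : X} (hv : v ≠ 0) : (supp (vecCoord b) v).Nonempty := by
  by_contra h
  refine hv (eq_of_coord_eq (b := b) fun n => ?_)
  rw [map_zero]
  by_contra hn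
  exact h ⟨n, hn⟩

theorem leftEnd_mem {v : X} (hv : v ≠ 0) : leftEnd b v ∈ supp (vecCoord b) v :=
  Nat.sInf_mem (supp_nonempty hv)

theorem leftEnd_le {v : X} {n : ℕ} (hn : n ∈ supp (vecCoord b) v) : leftEnd b v ≤ n :=
  Nat.sInf_le hn

section

variable {ι : Type*} [Fintype ι] {v : ι → X} {w : ι → ℝ}

theorem weight_nonneg (hw : ∀ i, 0 ≤ w i) (p q : ℕ) : 0 ≤ weight b v w p q :=
  Finset.sum_nonneg fun i _ => by split_ifs; exacts [hw i, le_rfl]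

theorem weight_add {p m q : ℕ} (h : p ≤ m) (h' : m ≤ q) :
    weight b v w p m + weight b v w m q = weight b v w p q := by
  simp only [weight, ← Finset.sum_add_distrib]
  refine Finset.sum_congr rfl fun i _ => ?_
  split_ifs <;> first | omega | simp

theorem weight_le_sum (hw : ∀ i, 0 ≤ w i) (p q : ℕ) : weight b v w p q ≤ ∑ i, w i :=
  Finset.sum_le_sum fun i _ => by split_ifs; exacts [le_rfl, hw i]

/-- The norm of a piece of a sum of successive vectors is controlled by the weight of the piece, up
to the error caused by the one vector that is cut at the left end. -/
theorem norm_icoProj_sum_le (hb : IsBimonotone b) (hne : ∀ i, v i ≠ 0)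
    (hdisj : ∀ i j, i ≠ j → Before (vecCoord b) (v i) (v j) ∨ Before (vecCoord b) (v j) (v i))
    {C δ : ℝ} (hC : 0 ≤ C) (hδ : 0 ≤ δ) (hv : ∀ i, ‖v i‖ ≤ C * w i) (hwδ : ∀ i, w i ≤ δ)
    (p q : ℕ) :
    ‖icoProj b p q (∑ i, v i)‖ ≤ C * (weight b v w p q + δ) := by
  classical
  set bad : Finset ι := Finset.univ.filter fun i =>
    icoProj b p q (v i) ≠ 0 ∧ leftEnd b (v i) < p with hbad
  have hcard : bad.card ≤ 1 := by
    have key : ∀ i ∈ bad, ∀ j ∈ bad, ¬ Before (vecCoord b) (v i) (v j) := by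
      intro i hi j hj h
      obtain ⟨n, hn⟩ := supp_nonempty (b := b) (Finset.mem_filter.1 hi).2.1
      have hn' := supp_icoProj_subset _ _ _ hn
      have h1 := h n hn'.2 _ (leftEnd_mem (hne j))
      have h2 := (Finset.mem_filter.1 hj).2.2
      have h3 := hn'.1.1
      omega
    rw [Finset.card_le_one]
    intro i hi j hj
    by_contra hij
    rcases hdisj i j hij with h | h
    · exact key i hi j hj h
    · exact key j hj i hi h
  have hterm : ∀ i, ‖icoProj b p q (v i)‖ ≤
      C * (if p ≤ leftEnd b (v i) ∧ leftEnd b (v i) < q then w i else 0) +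
        (if i ∈ bad then C * δ else 0) := by
    intro i
    have hle : ‖icoProj b p q (v i)‖ ≤ C * w i := (hb.norm_icoProj_le _ _ _).trans (hv i)
    have h0 : 0 ≤ (if i ∈ bad then C * δ else 0) := by split_ifs <;> positivity
    by_cases hz : icoProj b p q (v i) = 0
    · rw [hz, norm_zero]
      have : 0 ≤ C * w i := (norm_nonneg _).trans (hv i)
      split_ifs <;> positivity
    obtain ⟨n, hn⟩ := supp_nonempty (b := b) hz
    have hn' := supp_icoProj_subset _ _ _ hn
    have hlt : leftEnd b (v i) < q := (leftEnd_le hn'.2).trans_lt hn'.1.2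
    by_cases hp : p ≤ leftEnd b (v i)
    · rw [if_pos ⟨hp, hlt⟩]
      linarith
    · rw [if_neg (fun h => hp h.1), if_pos (by simp [hbad, hz]; omega)]
      have := mul_le_mul_of_nonneg_left (hwδ i) hC
      linarith
  rw [map_sum]
  refine (norm_sum_le_of_le _ fun i _ => hterm i).trans ?_
  rw [Finset.sum_add_distrib, ← Finset.mul_sum, Finset.sum_ite_mem, Finset.univ_inter,
    Finset.sum_const, nsmul_eq_mul, mul_add, weight]
  have : (bad.card : ℝ) ≤ 1 := by exact_mod_cast hcard
  exact add_le_add le_rfl (mul_le_of_le_one_left (by positivity) this)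

end

/-- The minimal interval argument: if large forms are bounded on the pieces of `x` and the norm of
the pieces is given by forms, then the norms of the pieces are controlled by `x / f x` of their
weights. -/
theorem norm_icoProj_le_ratioFn {f : ℝ → ℝ} (hf : IsClassF f) {x : X}
    {l : ℕ → ℕ → ℝ} {δ : ℝ} (hδ0 : 0 < δ) (hl0 : ∀ p q, 0 ≤ l p q)
    (hladd : ∀ {p m q}, p ≤ m → m ≤ q → l p m + l m q = l p q)
    (hbound : ∀ p q, ‖icoProj b p q x‖ ≤ 11 / 10 * (l p q + δ)) {M₀ : ℕ}
    (hsmall : ∀ M : ℕ, 2 ≤ M → M < M₀ → 11 / 5 * δ * M ≤ 4 * (f M - f (M - 1)))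
    (hlarge : ∀ M : ℕ, 2 ≤ M → M₀ ≤ M → ∀ c : ℕ → ℕ, Monotone c →
      ∑ k ∈ Finset.range M, ‖icoProj b (c k) (c (k + 1)) x‖ ≤ 3 * f M)
    (hform : ∀ p q : ℕ, 1 / 3 ≤ ‖intervalProj b p q x‖ →
      ‖intervalProj b p q x‖ ≤ formNorm b f (intervalProj b p q x)) (p q : ℕ) (hpq : δ ≤ l p q) :
    ‖icoProj b p q x‖ ≤ 4 * ratioFn f (l p q) := by
  obtain ⟨d, hd⟩ : ∃ d, q - p = d := ⟨_, rfl⟩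
  induction d using Nat.strong_induction_on generalizing p q with
  | _ d ih =>
  set t := l p q with ht
  rcases le_or_gt t 1 with ht1 | ht1
  · rw [hf.ratioFn_of_le ht1]
    linarith [hbound p q]
  have hr1 := hf.one_le_ratioFn ht1.le
  rcases le_or_gt q p with hqp | hqp
  · rw [icoProj_of_le b hqp]
    simp only [zero_apply, norm_zero]
    linarith
  rcases lt_or_ge ‖icoProj b p q x‖ (1 / 3) with h3 | h3
  · linarith
  have hf2 : 1 < f 2 := by
    have := hf.strictMono (Set.mem_Ici.2 le_rfl) (Set.mem_Ici.2 one_le_two) one_lt_two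
    rwa [hf.map_one] at this
  set y := icoProj b p q x with hy
  have hformbd : ∀ (M : ℕ) (φ : StrongDual 𝕜 X), 2 ≤ M → IsForm b f M φ →
      ‖φ y‖ ≤ max (4 * ratioFn f t) (‖y‖ / f 2) := by
    intro M φ hM hφ
    have hM1 : (1 : ℝ) ≤ M := by exact_mod_cast (by omega : 1 ≤ M)
    have hfM := hf.pos hM1
    obtain ⟨c, hc, hc', hcφ⟩ := hφ.exists_cuts hf (by omega) hqp.le x
    rw [← hy] at hcφ
    have reduce : ∀ B, ∑ k ∈ Finset.range M, ‖icoProj b (c k) (c (k + 1)) x‖ ≤ f M * B →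
        ‖φ y‖ ≤ B := fun B hB => le_of_mul_le_mul_left (hcφ.trans hB) hfM
    rcases le_or_gt M₀ M with hMM | hMM
    · refine le_max_of_le_left (reduce _ ((hlarge M hM hMM c hc).trans ?_))
      rw [mul_comm]
      gcongr
      linarith
    by_cases hwhole : ∃ k₀ < M, c k₀ = p ∧ c (k₀ + 1) = q
    · obtain ⟨k₀, hk₀, hk1, hk2⟩ := hwhole
      refine le_max_of_le_right (reduce _ ?_)
      rw [Finset.sum_eq_single_of_mem k₀ (Finset.mem_range.2 hk₀), hk1, hk2, ← hy]
      · rw [← mul_div_assoc, le_div_iff₀ (by linarith), mul_comm]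
        gcongr
        exact hf.monotoneOn one_le_two (by exact_mod_cast hM)
      · intro k _ hk
        have h1 := hc' k
        have h2 := hc' (k + 1)
        rw [icoProj_of_le, zero_apply, norm_zero]
        rcases lt_or_gt_of_ne hk with h | h
        · have := hc (show k + 1 ≤ k₀ by omega)
          omega
        · have := hc (show k₀ + 1 ≤ k by omega)
          omega
    refine le_max_of_le_left (reduce _ ?_)
    classical
    set S := (Finset.range M).filter fun k => δ ≤ l (c k) (c (k + 1)) with hS
    have hSsub : S ⊆ Finset.range M := Finset.filter_subset _ _
    have hbig : ∀ k ∈ S, ‖icoProj b (c k) (c (k + 1)) x‖ ≤ 4 * ratioFn f (l (c k) (c (k + 1))) := by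
      intro k hk
      rw [hS, Finset.mem_filter, Finset.mem_range] at hk
      refine ih _ ?_ _ _ hk.2 rfl
      have h1 := hc' k
      have h2 := hc' (k + 1)
      by_contra hcon
      exact hwhole ⟨k, hk.1, by omega, by omega⟩
    have hsm : ∀ k ∈ Finset.range M \ S, ‖icoProj b (c k) (c (k + 1)) x‖ ≤ 11 / 5 * δ := by
      intro k hk
      rw [Finset.mem_sdiff, hS, Finset.mem_filter] at hk
      have : l (c k) (c (k + 1)) < δ := by
        by_contra h
        exact hk.2 ⟨hk.1, not_lt.1 h⟩
      linarith [hbound (c k) (c (k + 1))]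
    have hlsum : ∑ k ∈ S, l (c k) (c (k + 1)) ≤ t := by
      have h1 : ∀ m, l (c 0) (c 0) + ∑ k ∈ Finset.range m, l (c k) (c (k + 1)) = l (c 0) (c m) := by
        intro m
        induction m with
        | zero => simp
        | succ m ihm =>
          rw [Finset.sum_range_succ, ← add_assoc, ihm, hladd (hc (Nat.zero_le _)) (hc (Nat.le_succ _))]
      have h2 := h1 M
      have h3 : ∑ k ∈ S, l (c k) (c (k + 1)) ≤ ∑ k ∈ Finset.range M, l (c k) (c (k + 1)) :=
        Finset.sum_le_sum_of_subset_of_nonneg hSsub fun _ _ _ => hl0 _ _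
      have h4 := hladd (hc' 0).1 (hc' 0).2
      have h5 := hladd (hc (Nat.zero_le M)) (hc' M).2
      linarith [hl0 (c 0) (c 0), hl0 p (c 0), hl0 (c M) q]
    rw [← Finset.sum_sdiff hSsub]
    have hA : ∑ k ∈ S, ‖icoProj b (c k) (c (k + 1)) x‖ ≤
        4 * ∑ k ∈ S, ratioFn f (l (c k) (c (k + 1))) := by
      rw [Finset.mul_sum]
      exact Finset.sum_le_sum hbig
    have hB : ∑ k ∈ Finset.range M \ S, ‖icoProj b (c k) (c (k + 1)) x‖ ≤
        (Finset.range M \ S).card * (11 / 5 * δ) := by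
      simpa using Finset.sum_le_sum hsm
    rcases Finset.eq_empty_or_nonempty (Finset.range M \ S) with hE | hE
    · have hSM : S = Finset.range M := hSsub.antisymm (Finset.sdiff_eq_empty_iff_subset.1 hE)
      have h1 := hf.sum_ratioFn_le S (by rw [hSM]; exact ⟨0, by simp; omega⟩) _
        (fun k _ => hl0 _ _) ht1.le hlsum
      rw [show S.card = M by rw [hSM, Finset.card_range]] at h1
      rw [hE, Finset.sum_empty, zero_add]
      linarith
    · have hcard : (Finset.range M \ S).card + S.card = M := by
        rw [Finset.card_sdiff_add_card_eq_card hSsub, Finset.card_range]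
      have hE1 := hE.card_pos
      have hM1' : (1 : ℝ) ≤ (M : ℝ) - 1 := by
        have : (2 : ℝ) ≤ M := by exact_mod_cast hM
        linarith
      have h1 : ∑ k ∈ S, ratioFn f (l (c k) (c (k + 1))) ≤ f (M - 1) * ratioFn f t := by
        rcases S.eq_empty_or_nonempty with hSe | hSn
        · rw [hSe, Finset.sum_empty]
          have := hf.pos hM1'
          positivity
        · refine (hf.sum_ratioFn_le S hSn _ (fun k _ => hl0 _ _) ht1.le hlsum).trans ?_
          gcongr
          refine hf.monotoneOn (by exact_mod_cast hSn.card_pos) ?_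
          rw [le_sub_iff_add_le]
          exact_mod_cast (by omega : S.card + 1 ≤ M)
      have h2 := hsmall M hM hMM
      have h3 : ((Finset.range M \ S).card : ℝ) * (11 / 5 * δ) ≤ 11 / 5 * δ * M := by
        rw [mul_comm]
        gcongr
        omega
      have h4 : f (M - 1) ≤ f M := hf.monotoneOn hM1' (by linarith)
      nlinarith
  have hmain : ‖y‖ ≤ max (4 * ratioFn f t) (‖y‖ / f 2) := by
    obtain ⟨q', rfl⟩ : ∃ q', q = q' + 1 := ⟨q - 1, by omega⟩
    have h := hform p q'
    rw [← icoProj_eq_intervalProj, ← hy] at h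
    refine (h h3).trans (Real.sSup_le ?_ (le_max_of_le_left (by linarith)))
    rintro r ⟨M, φ, hM, hφ, rfl⟩
    exact hformbd M φ hM hφ
  rcases le_max_iff.1 hmain with h | h
  · exact h
  · rw [le_div_iff₀ (by linarith)] at h
    nlinarith

end Weights


section RISBound

variable {𝕜 X : Type*} [RCLike 𝕜] [NormedAddCommGroup X] [NormedSpace 𝕜 X]
variable {b : SchauderBasis 𝕜 X} {f : ℝ → ℝ}

theorem supp_subset_supp_sum {ι : Type*} [Fintype ι] [LinearOrder ι] {u : ι → X}
    (hu : IsBlockSeq (vecCoord b) u) (j : ι) :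
    supp (vecCoord b) (u j) ⊆ supp (vecCoord b) (∑ i, u i) := by
  intro n hn
  show b.coord n (∑ i, u i) ≠ 0
  rw [map_sum, Finset.sum_eq_single j]
  · exact hn
  · intro i _ hij
    by_contra hi
    rcases lt_or_gt_of_ne hij with h | h
    · exact (hu.successive i j h n hi n hn).false
    · exact (hu.successive j i h n hn n hi).false
  · simp

theorem sum_icoProj_norm_le_ncard (hb : IsBimonotone b) {c : ℕ → ℕ} (hc : Monotone c) (M : ℕ)
    {y : X} (hy : (supp (vecCoord b) y).Finite) :
    ∑ k ∈ Finset.range M, ‖icoProj b (c k) (c (k + 1)) y‖ ≤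
      (ran (vecCoord b) y).ncard * ‖y‖ := by
  have h1 : ∀ a e, ‖icoProj b a e y‖ ≤ ∑ n ∈ Finset.Ico a e, ‖icoProj b n (n + 1) y‖ := by
    intro a e
    rw [icoProj_apply]
    refine norm_sum_le_of_le _ fun n _ => ?_
    simp [icoProj_apply]
  have h2 : ∑ k ∈ Finset.range M, ‖icoProj b (c k) (c (k + 1)) y‖ ≤
      ∑ n ∈ Finset.Ico (c 0) (c M), ‖icoProj b n (n + 1) y‖ := by
    induction M with
    | zero => simp
    | succ M ih =>
      rw [Finset.sum_range_succ,
        ← Finset.sum_Ico_consecutive _ (hc (Nat.zero_le M)) (hc (Nat.le_succ M))]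
      exact add_le_add ih (h1 _ _)
  have hsub : supp (vecCoord b) y ⊆ ran (vecCoord b) y := fun n hn => ⟨n, hn, n, hn, le_rfl, le_rfl⟩
  have hran : (ran (vecCoord b) y).Finite := by
    obtain ⟨B, hB⟩ := hy.bddAbove
    refine (Set.finite_Iic B).subset ?_
    rintro n ⟨-, -, q, hq, -, hnq⟩
    exact hnq.trans (hB hq)
  refine h2.trans ?_
  have h3 : ∑ n ∈ Finset.Ico (c 0) (c M), ‖icoProj b n (n + 1) y‖ ≤
      ∑ n ∈ hy.toFinset, ‖y‖ := by
    classical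
    rw [← Finset.sum_filter_add_sum_filter_not (Finset.Ico (c 0) (c M))
      (fun n => n ∈ supp (vecCoord b) y)]
    rw [Finset.sum_eq_zero (s := Finset.filter (fun n => n ∉ supp (vecCoord b) y) _), add_zero]
    · refine (Finset.sum_le_sum fun n _ => hb.norm_icoProj_le n (n + 1) y).trans ?_
      refine Finset.sum_le_sum_of_subset_of_nonneg ?_ fun _ _ _ => norm_nonneg _
      intro n hn
      simpa using (Finset.mem_filter.1 hn).2
    · intro n hn
      have : b.coord n y = 0 := not_not.1 (Finset.mem_filter.1 hn).2
      simp [icoProj_apply, this]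
  refine h3.trans ?_
  rw [Finset.sum_const, nsmul_eq_mul]
  gcongr
  rw [← Set.ncard_eq_toFinset_card _ hy]
  exact Set.ncard_le_ncard hsub hran

theorem weight_sum_cuts {ι : Type*} [Fintype ι] {v : ι → X} {w : ι → ℝ} (hw : ∀ i, 0 ≤ w i)
    {c : ℕ → ℕ} (hc : Monotone c) (M : ℕ) :
    ∑ k ∈ Finset.range M, weight b v w (c k) (c (k + 1)) ≤ ∑ i, w i := by
  have h1 : ∑ k ∈ Finset.range M, weight b v w (c k) (c (k + 1)) ≤ weight b v w (c 0) (c M) := by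
    induction M with
    | zero => simpa using weight_nonneg hw _ _
    | succ M ih =>
      rw [Finset.sum_range_succ, ← weight_add (hc (Nat.zero_le M)) (hc (Nat.le_succ M))]
      exact add_le_add ih le_rfl
  exact h1.trans (weight_le_sum hw _ _)

/-- Cutting a long average into few pieces. -/
theorem IsL1Average.sum_norm_icoProj_le (hb : IsBimonotone b) {n : ℕ} (hn : 1 ≤ n) {C : ℝ}
    (hC : 0 ≤ C) {v : X} (hv : IsL1Average b n C v) {c : ℕ → ℕ} (hc : Monotone c) {M : ℕ}
    (hM : M ≤ n) :
    ∑ k ∈ Finset.range M, ‖icoProj b (c k) (c (k + 1)) v‖ ≤ 2 * C := by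
  obtain ⟨-, u, hu, hun, rfl⟩ := hv
  have hn0 : (0 : ℝ) < n := by exact_mod_cast hn
  have h1 : ∀ p q, ‖icoProj b p q (∑ i, u i)‖ ≤
      C * (weight b u (fun _ => (n : ℝ)⁻¹) p q + (n : ℝ)⁻¹) :=
    norm_icoProj_sum_le hb hu.ne_zero (fun i j hij => by
      rcases lt_or_gt_of_ne hij with h | h
      · exact Or.inl (hu.successive i j h)
      · exact Or.inr (hu.successive j i h)) hC (by positivity)
      (fun i => by simpa [div_eq_mul_inv] using hun i) (fun _ => le_rfl)
  refine (Finset.sum_le_sum fun k _ => h1 (c k) (c (k + 1))).trans ?_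
  rw [← Finset.mul_sum, Finset.sum_add_distrib, mul_comm 2 C]
  have h2 := weight_sum_cuts (b := b) (v := u) (w := fun _ => (n : ℝ)⁻¹)
    (fun _ => by positivity) hc M
  have h3 : (M : ℝ) * (n : ℝ)⁻¹ ≤ 1 := by
    rw [← div_eq_mul_inv, div_le_one hn0]
    exact_mod_cast hM
  simp only [Finset.sum_const, Finset.card_univ, Fintype.card_fin, nsmul_eq_mul,
    mul_inv_cancel₀ hn0.ne', Finset.card_range] at h2 ⊢
  gcongr
  linarith

theorem sum_pieces_sum_le {ι : Type*} (s : Finset ι) (x : ι → X) (c : ℕ → ℕ) (M : ℕ) :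
    ∑ k ∈ Finset.range M, ‖icoProj b (c k) (c (k + 1)) (∑ i ∈ s, x i)‖ ≤
      ∑ i ∈ s, ∑ k ∈ Finset.range M, ‖icoProj b (c k) (c (k + 1)) (x i)‖ := by
  rw [Finset.sum_comm]
  refine Finset.sum_le_sum fun k _ => ?_
  rw [map_sum]
  exact norm_sum_le _ _

/-- Large forms are bounded on rapidly increasing sums. -/
theorem sum_pieces_le (hlow : LowerEstimate b f) (hf : IsClassF f) (hb : IsBimonotone b) {N : ℕ}
    {x : Fin N → X} (hx : IsBlockSeq (vecCoord b) x) {n : Fin N → ℕ} (hn : ∀ i, 1 ≤ n i)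
    (hav : ∀ i, IsL1Average b (n i) (1 + 1 / 10) (x i))
    (hran : ∀ k : Fin N, 0 < (k : ℕ) →
      ((ran (vecCoord b) (∑ i with i < k, x i)).ncard : ℝ) ≤ 1 / 20 * Real.sqrt (f (n k)))
    {M : ℕ} (hM : 1 ≤ M) (hfM : (4 * N : ℝ) ^ 2 ≤ f M) {c : ℕ → ℕ} (hc : Monotone c) :
    ∑ k ∈ Finset.range M, ‖icoProj b (c k) (c (k + 1)) (∑ i, x i)‖ ≤ 3 * f M := by
  classical
  have hM1 : (1 : ℝ) ≤ M := by exact_mod_cast hM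
  have hfM1 := hf.one_le hM1
  have hN : (4 * N : ℝ) ≤ f M := by
    rcases Nat.eq_zero_or_pos N with rfl | hN
    · simp; linarith
    · have : (1 : ℝ) ≤ N := by exact_mod_cast hN
      nlinarith
  have hbig : ∀ s : Finset (Fin N), (∀ i ∈ s, M ≤ n i) →
      ∑ k ∈ Finset.range M, ‖icoProj b (c k) (c (k + 1)) (∑ i ∈ s, x i)‖ ≤ f M := by
    intro s hs
    have h1 := (sum_pieces_sum_le (b := b) s x c M).trans (Finset.sum_le_sum fun i hi =>
      (hav i).sum_norm_icoProj_le hb (hn i) (by norm_num) hc (hs i hi))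
    have h2 : (s.card : ℝ) ≤ N := by
      exact_mod_cast (Finset.card_le_univ s).trans_eq (Fintype.card_fin N)
    rw [Finset.sum_const, nsmul_eq_mul] at h1
    linarith
  set small : Finset (Fin N) := Finset.univ.filter fun i => n i < M with hsmall
  rcases small.eq_empty_or_nonempty with he | hne
  · have := hbig Finset.univ fun i hi => by
      by_contra h
      have : i ∈ small := by simpa [hsmall] using h
      rw [he] at this
      simp at this
    linarith
  set i₀ := small.max' hne with hi₀
  have hi₀M : n i₀ < M := (Finset.mem_filter.1 (small.max'_mem hne)).2
  have hsplit : ∑ i, x i = ∑ i with i < i₀, x i + (x i₀ + ∑ i with i₀ < i, x i) := by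
    rw [← Finset.sum_filter_add_sum_filter_not Finset.univ (fun i => i < i₀)]
    congr 1
    have : (Finset.univ.filter fun i => ¬ i < i₀) = insert i₀ (Finset.univ.filter fun i => i₀ < i) := by
      ext i
      simp [le_iff_eq_or_lt, eq_comm]
    rw [this, Finset.sum_insert (by simp)]
  rw [hsplit]
  simp only [map_add]
  refine (Finset.sum_le_sum fun k _ => (norm_add_le _ _).trans
    (add_le_add le_rfl (norm_add_le _ _))).trans ?_
  rw [Finset.sum_add_distrib, Finset.sum_add_distrib]
  have h3 := hbig (Finset.univ.filter fun i => i₀ < i) fun i hi => by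
    by_contra h
    have hi' : i ∈ small := by simpa [hsmall] using h
    exact absurd (small.le_max' i hi') (not_le.2 (Finset.mem_filter.1 hi).2)
  have h2 := hlow.sum_norm_icoProj_le hf hb hc hM (x i₀)
  rw [(hav i₀).1, mul_one] at h2
  have h1 : ∑ k ∈ Finset.range M, ‖icoProj b (c k) (c (k + 1)) (∑ i with i < i₀, x i)‖ ≤ f M := by
    rcases Nat.eq_zero_or_pos (i₀ : ℕ) with h0 | h0
    · have : (Finset.univ.filter fun i => i < i₀) = ∅ := by
        ext i
        simp [Fin.le_def, h0]
      rw [this]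
      simp
      linarith
    have hfin : (supp (vecCoord b) (∑ i with i < i₀, x i)).Finite := by
      refine (Set.finite_iUnion hx.finite_supp).subset fun m hm => ?_
      obtain ⟨i, -, hi⟩ := coord_ne_zero_of_sum hm
      exact Set.mem_iUnion.2 ⟨i, hi⟩
    refine (sum_icoProj_norm_le_ncard hb hc M hfin).trans ?_
    have hnorm : ‖∑ i with i < i₀, x i‖ ≤ N := by
      refine (norm_sum_le _ _).trans ?_
      simp only [(hav _).1, Finset.sum_const, nsmul_eq_mul, mul_one]
      exact_mod_cast (Finset.card_le_univ _).trans_eq (Fintype.card_fin N)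
    have hsq : Real.sqrt (f (n i₀)) ≤ Real.sqrt (f M) :=
      Real.sqrt_le_sqrt (hf.monotoneOn (by exact_mod_cast hn i₀) (by exact_mod_cast hi₀M.le))
    have hNs : (4 * N : ℝ) ≤ Real.sqrt (f M) := Real.le_sqrt_of_sq_le hfM
    have hss : Real.sqrt (f M) * Real.sqrt (f M) = f M := Real.mul_self_sqrt (by linarith)
    have hs0 := Real.sqrt_nonneg (f M)
    calc _ ≤ 1 / 20 * Real.sqrt (f M) * N := by
          gcongr
          exact (hran i₀ h0).trans (by gcongr)
      _ ≤ 1 / 20 * Real.sqrt (f M) * Real.sqrt (f M) := by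
          gcongr
          linarith [(Nat.cast_nonneg N : (0 : ℝ) ≤ N)]
      _ ≤ f M := by rw [mul_assoc, hss]; linarith
  linarith

theorem IsClassF.exists_gap (hf : IsClassF f) (M₀ : ℕ) :
    ∃ A : ℕ, 1 ≤ A ∧ ∀ M : ℕ, 2 ≤ M → M < M₀ → (M : ℝ) ≤ A * (f M - f (M - 1)) := by
  induction M₀ with
  | zero => exact ⟨1, le_rfl, fun M _ h => absurd h (Nat.not_lt_zero _)⟩
  | succ M₀ ih =>
    obtain ⟨A, hA1, hA⟩ := ih
    obtain ⟨B, hB⟩ := exists_nat_ge ((M₀ : ℝ) / (f M₀ - f (M₀ - 1)))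
    refine ⟨max A B, hA1.trans (le_max_left _ _), fun M hM hM' => ?_⟩
    have h2 : (2 : ℝ) ≤ M := by exact_mod_cast hM
    have hgap : 0 < f M - f (M - 1) :=
      sub_pos.2 (hf.strictMono (by simp; linarith) (by simp; linarith) (by linarith))
    rcases (Nat.lt_succ_iff.1 hM').eq_or_lt with rfl | h
    · rw [div_le_iff₀ hgap] at hB
      refine hB.trans ?_
      gcongr
      exact le_max_right _ _
    · refine (hA M hM h).trans ?_
      gcongr
      exact le_max_left _ _

/-- The upper estimate for rapidly increasing sums. -/
theorem exists_norm_sum_le (hlow : LowerEstimate b f) (hf : IsClassF f) (hb : IsBimonotone b)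
    {N : ℕ} (hN : 1 ≤ N) :
    ∃ A : ℕ, 1 ≤ A ∧ ∀ (x : Fin N → X) (n : Fin N → ℕ), IsBlockSeq (vecCoord b) x →
      (∀ i, A ≤ n i) → (∀ i, IsL1Average b (n i) (1 + 1 / 10) (x i)) →
      (∀ k : Fin N, 0 < (k : ℕ) →
        ((ran (vecCoord b) (∑ i with i < k, x i)).ncard : ℝ) ≤ 1 / 20 * Real.sqrt (f (n k))) →
      (∀ p q : ℕ, 1 / 3 ≤ ‖intervalProj b p q (∑ i, x i)‖ →
        ‖intervalProj b p q (∑ i, x i)‖ ≤ formNorm b f (intervalProj b p q (∑ i, x i))) →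
      ‖∑ i, x i‖ ≤ 4 * (N / f N) := by
  have hN1 : (1 : ℝ) ≤ N := by exact_mod_cast hN
  obtain ⟨M₀, hM₀⟩ := ((hf.tendsto_atTop.comp tendsto_natCast_atTop_atTop).eventually
    (eventually_ge_atTop ((4 * N : ℝ) ^ 2))).exists_forall_of_atTop
  obtain ⟨A, hA1, hA⟩ := hf.exists_gap M₀
  refine ⟨A, hA1, fun x n hx hnA hav hran hform => ?_⟩
  have hA0 : (0 : ℝ) < A := by exact_mod_cast hA1
  have hn1 : ∀ i, 1 ≤ n i := fun i => hA1.trans (hnA i)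
  choose hnorm u hu hun hsum using hav
  set v : (Σ i, Fin (n i)) → X := fun a => u a.1 a.2 with hv
  set w : (Σ i, Fin (n i)) → ℝ := fun a => (n a.1 : ℝ)⁻¹ with hw
  have hw0 : ∀ a, 0 ≤ w a := fun a => by positivity
  have hxv : ∑ i, x i = ∑ a, v a := by
    rw [Fintype.sum_sigma]
    exact Finset.sum_congr rfl fun i _ => hsum i
  have hsupp : ∀ a, supp (vecCoord b) (v a) ⊆ supp (vecCoord b) (x a.1) := fun a => by
    rw [hsum a.1]
    exact supp_subset_supp_sum (hu a.1) a.2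
  have hdisj : ∀ a a', a ≠ a' →
      Before (vecCoord b) (v a) (v a') ∨ Before (vecCoord b) (v a') (v a) := by
    rintro ⟨i, j⟩ ⟨i', j'⟩ hne
    rcases lt_trichotomy i i' with h | rfl | h
    · exact Or.inl fun p hp q hq => hx.successive i i' h p (hsupp _ hp) q (hsupp _ hq)
    · rcases lt_trichotomy j j' with h | rfl | h
      · exact Or.inl ((hu i).successive j j' h)
      · exact absurd rfl hne
      · exact Or.inr ((hu i).successive j' j h)
    · exact Or.inr fun p hp q hq => hx.successive i' i h p (hsupp _ hp) q (hsupp _ hq)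
  have hbound : ∀ p q, ‖icoProj b p q (∑ i, x i)‖ ≤
      11 / 10 * (weight b v w p q + (A : ℝ)⁻¹) := by
    intro p q
    rw [hxv]
    refine norm_icoProj_sum_le (v := v) (w := w) (δ := (A : ℝ)⁻¹) hb (fun a => (hu a.1).ne_zero a.2) hdisj (by norm_num)
      (by positivity) (fun a => ?_) (fun a => ?_) p q
    · refine (hun a.1 a.2).trans (le_of_eq ?_)
      rw [hw, div_eq_mul_inv]
      norm_num
    · exact inv_anti₀ hA0 (by exact_mod_cast hnA a.1)
  obtain ⟨q, hq⟩ : ∃ q, ∀ a, ∀ m ∈ supp (vecCoord b) (v a), m < q := by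
    obtain ⟨q, -, hq⟩ := exists_supp_subset (c := vecCoord b) (v := ∑ i, x i) (by
      refine (Set.finite_iUnion hx.finite_supp).subset fun m hm => ?_
      obtain ⟨i, -, hi⟩ := coord_ne_zero_of_sum hm
      exact Set.mem_iUnion.2 ⟨i, hi⟩) 0
    exact ⟨q, fun a m hm => hq m (supp_subset_supp_sum hx a.1 (hsupp a hm))⟩
  have hwN : weight b v w 0 q = N := by
    have h1 : weight b v w 0 q = ∑ a, w a := Finset.sum_congr rfl fun a _ =>
      if_pos ⟨Nat.zero_le _, hq a _ (leftEnd_mem ((hu a.1).ne_zero a.2))⟩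
    rw [h1, Fintype.sum_sigma]
    have : ∀ i, ∑ j : Fin (n i), w ⟨i, j⟩ = 1 := fun i => by
      have : (n i : ℝ) ≠ 0 := by exact_mod_cast (by have := hn1 i; omega : n i ≠ 0)
      simp [hw, this]
    simp [this]
  have hself : icoProj b 0 q (∑ i, x i) = ∑ i, x i := by
    rw [icoProj_eq_self_iff, hxv]
    intro m hm
    obtain ⟨a, -, ha⟩ := coord_ne_zero_of_sum hm
    exact ⟨Nat.zero_le _, hq a m ha⟩
  have hmain := norm_icoProj_le_ratioFn hf (inv_pos.2 hA0) (weight_nonneg hw0)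
    (fun h h' => weight_add h h') hbound (M₀ := M₀) ?_ ?_ hform 0 q ?_
  · rwa [hself, hwN, ratioFn_of_ge hN1] at hmain
  · intro M hM hM'
    have h1 := hA M hM hM'
    have h2 : 11 / 5 * (A : ℝ)⁻¹ * M ≤ 11 / 5 * (A : ℝ)⁻¹ * (A * (f M - f (M - 1))) := by
      gcongr
    have h3 : (A : ℝ)⁻¹ * (A * (f M - f (M - 1))) = f M - f (M - 1) := by field_simp
    have h4 : 0 ≤ f M - f (M - 1) := by
      have h5 : (2 : ℝ) ≤ M := by exact_mod_cast hM
      exact sub_nonneg.2 (hf.monotoneOn (by linarith) (by linarith))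
    rw [mul_assoc _ _ ((A : ℝ) * _), h3] at h2
    linarith
  · intro M hM hM' c hc
    exact sum_pieces_le hlow hf hb hx hn1 (fun i => ⟨hnorm i, u i, hu i, hun i, hsum i⟩) hran
      (by omega) (hM₀ M hM') hc
  · rw [hwN]
    exact (inv_le_one_of_one_le₀ (by exact_mod_cast hA1)).trans hN1

end RISBound


/-- Successive choices, each depending on the end point of the previous one. -/
theorem exists_chain {T : Type*} {R : ℕ → ℕ → ℕ → T → Prop}
    (h : ∀ i p, ∃ q t, p ≤ q ∧ R i p q t) (p₀ : ℕ) :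
    ∃ (c : ℕ → ℕ) (t : ℕ → T), Monotone c ∧ c 0 = p₀ ∧ ∀ i, R i (c i) (c (i + 1)) (t i) := by
  choose q t hq hR using h
  let c : ℕ → ℕ := fun n => Nat.rec p₀ (fun i p => q i p) n
  exact ⟨c, fun i => t i (c i), monotone_nat_of_le_succ fun i => hq i (c i), rfl,
    fun i => hR i (c i)⟩

section Coordinates

variable {𝕜 V : Type*} [RCLike 𝕜] [NormedAddCommGroup V] [NormedSpace 𝕜 V]

/-- Linear coordinates that separate points. -/
structure IsCoordSystem (c : ℕ → V → 𝕜) : Prop where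
  linear : ∀ n, IsLinearMap 𝕜 (c n)
  separating : ∀ v, (∀ n, c n v = 0) → v = 0

/-- Contractive interval projections that converge to the identity. -/
structure IsProjSystem (c : ℕ → V → 𝕜) (P : ℕ → ℕ → V →L[𝕜] V) : Prop where
  coord : ∀ n a e v, c n (P a e v) = if a ≤ n ∧ n < e then c n v else 0
  norm_le : ∀ a e v, ‖P a e v‖ ≤ ‖v‖
  tendsto : ∀ v, Tendsto (fun q => P 0 q v) atTop (𝓝 v)

variable {c : ℕ → V → 𝕜}

theorem IsCoordSystem.eq_of_coord (hc : IsCoordSystem c) {v w : V} (h : ∀ n, c n v = c n w) :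
    v = w :=
  sub_eq_zero.1 (hc.separating _ fun n => by rw [(hc.linear n).map_sub, h, sub_self])

theorem IsCoordSystem.map_sum (hc : IsCoordSystem c) (n : ℕ) {ι : Type*} (s : Finset ι)
    (x : ι → V) : c n (∑ i ∈ s, x i) = ∑ i ∈ s, c n (x i) :=
  _root_.map_sum ((hc.linear n).mk' (c n)) x s

theorem IsCoordSystem.supp_sum (hc : IsCoordSystem c) {ι : Type*} {s : Finset ι} {x : ι → V}
    {n : ℕ} (h : n ∈ supp c (∑ i ∈ s, x i)) : ∃ i ∈ s, n ∈ supp c (x i) := by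
  by_contra! hcon
  apply h
  rw [hc.map_sum]
  exact Finset.sum_eq_zero fun i hi => not_not.1 (hcon i hi)

theorem IsCoordSystem.supp_smul_subset (hc : IsCoordSystem c) (a : 𝕜) (v : V) :
    supp c (a • v) ⊆ supp c v := by
  intro n hn h
  exact hn (by rw [(hc.linear n).map_smul, h, smul_zero])

theorem IsCoordSystem.supp_nonempty (hc : IsCoordSystem c) {v : V} (hv : v ≠ 0) :
    (supp c v).Nonempty := by
  by_contra h
  exact hv (hc.separating v fun n => by_contra fun hn => h ⟨n, hn⟩)

theorem IsCoordSystem.supp_subset_supp_sum (hc : IsCoordSystem c) {ι : Type*} [LinearOrder ι]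
    {u : ι → V} (hu : ∀ i j, i < j → Before c (u i) (u j)) {s : Finset ι} {j : ι} (hj : j ∈ s) :
    supp c (u j) ⊆ supp c (∑ i ∈ s, u i) := by
  intro n hn
  show c n (∑ i ∈ s, u i) ≠ 0
  rw [hc.map_sum, Finset.sum_eq_single_of_mem j hj]
  · exact hn
  · intro i _ hij
    by_contra hi
    rcases lt_or_gt_of_ne hij with h | h
    · exact (hu i j h n hi n hn).false
    · exact (hu j i h n hn n hi).false

theorem IsBlockSeq.smul (hc : IsCoordSystem c) {ι : Type*} [LT ι] {u : ι → V}
    (hu : IsBlockSeq c u) {a : ι → 𝕜} (ha : ∀ i, a i ≠ 0) : IsBlockSeq c fun i => a i • u i :=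
  ⟨fun i => smul_ne_zero (ha i) (hu.ne_zero i),
    fun i => (hu.finite_supp i).subset (hc.supp_smul_subset _ _),
    fun i j hij p hp q hq => hu.successive i j hij p (hc.supp_smul_subset _ _ hp) q
      (hc.supp_smul_subset _ _ hq)⟩

theorem IsBlockSeq.le_of_mem_supp (hc : IsCoordSystem c) {u : ℕ → V} (hu : IsBlockSeq c u)
    (k : ℕ) : ∀ m ∈ supp c (u k), k ≤ m := by
  induction k with
  | zero => exact fun m _ => Nat.zero_le m
  | succ k ih =>
    intro m hm
    obtain ⟨p, hp⟩ := hc.supp_nonempty (hu.ne_zero k)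
    exact (ih p hp).trans_lt (hu.successive k (k + 1) k.lt_succ_self p hp m hm)

/-- The sums of consecutive chunks of a block sequence form a block sequence. -/
theorem IsBlockSeq.chunk (hc : IsCoordSystem c) {u : ℕ → V} (hu : IsBlockSeq c u) {K : ℕ}
    (hK : 1 ≤ K) (s n : ℕ) :
    IsBlockSeq c fun j : Fin n => ∑ i ∈ Finset.range K, u (s + j * K + i) := by
  refine ⟨fun j => ?_, fun j => ?_, ?_⟩
  · obtain ⟨m, hm⟩ := hc.supp_nonempty (hu.ne_zero (s + j * K + 0))
    have h := hc.supp_subset_supp_sum (u := fun i => u (s + j * K + i))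
      (fun i i' h => hu.successive _ _ (by omega)) (Finset.mem_range.2 hK) hm
    intro h0
    rw [h0] at h
    exact h ((hc.linear m).map_zero)
  · refine (Set.finite_iUnion fun i : Fin K => hu.finite_supp (s + j * K + i)).subset fun m hm => ?_
    obtain ⟨i, hi, hi'⟩ := hc.supp_sum hm
    exact Set.mem_iUnion.2 ⟨⟨i, Finset.mem_range.1 hi⟩, hi'⟩
  · intro j j' hjj p hp q hq
    obtain ⟨i, hi, hi'⟩ := hc.supp_sum hp
    obtain ⟨l, hl, hl'⟩ := hc.supp_sum hq
    refine hu.successive _ _ ?_ p hi' q hl'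
    rw [Finset.mem_range] at hi
    have h1 : (j : ℕ) + 1 ≤ j' := hjj
    have h2 := Nat.mul_le_mul_right K h1
    rw [Nat.add_mul, one_mul] at h2
    omega

theorem sum_range_mul {E : Type*} [AddCommMonoid E] (g : ℕ → E) (s n K : ℕ) :
    ∑ i ∈ Finset.range (n * K), g (s + i) =
      ∑ j : Fin n, ∑ i ∈ Finset.range K, g (s + j * K + i) := by
  rw [Fin.sum_univ_eq_sum_range (fun j => ∑ i ∈ Finset.range K, g (s + j * K + i))]
  induction n with
  | zero => simp
  | succ n ih =>
    rw [Nat.add_mul, one_mul, Finset.sum_range_add, ih, Finset.sum_range_succ]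
    simp only [add_assoc]

/-- A normalized tail of a block sequence. -/
theorem IsBlockSeq.exists_normalized (hc : IsCoordSystem c) {u : ℕ → V} (hu : IsBlockSeq c u)
    {Y : Submodule 𝕜 V} (huY : ∀ k, u k ∈ Y) (p : ℕ) :
    ∃ w : ℕ → V, IsBlockSeq c w ∧ (∀ k, ‖w k‖ = 1) ∧ (∀ k, w k ∈ Y) ∧
      ∀ k, ∀ m ∈ supp c (w k), p ≤ m := by
  have h0 : ∀ k, ‖u k‖ ≠ 0 := fun k => norm_ne_zero_iff.2 (hu.ne_zero k)
  have hu' : IsBlockSeq c fun k => u (p + k) :=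
    ⟨fun i => hu.ne_zero _, fun i => hu.finite_supp _, fun i j h => hu.successive _ _ (by omega)⟩
  refine ⟨fun k => ((‖u (p + k)‖ : 𝕜)⁻¹) • u (p + k),
    hu'.smul hc fun k => inv_ne_zero (RCLike.ofReal_ne_zero.2 (h0 _)), fun k => ?_,
    fun k => Y.smul_mem _ (huY _), fun k m hm => ?_⟩
  · rw [norm_smul, norm_inv, RCLike.norm_ofReal, abs_of_nonneg (norm_nonneg _),
      inv_mul_cancel₀ (h0 _)]
  · exact (Nat.le_add_right p k).trans
      (hu.le_of_mem_supp hc _ m (hc.supp_smul_subset _ _ hm))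

/-- Normalized successive vectors in prescribed subspaces can be chosen with sums of norms of
different orders of magnitude. -/
def HasInhomogeneousSums (c : ℕ → V → 𝕜) : Prop :=
  ∀ M : ℝ, 1 ≤ M → ∃ n : ℕ, ∀ Y Z : Fin n → Submodule 𝕜 V,
    (∀ i, ∃ u : ℕ → V, IsBlockSeq c u ∧ ∀ k, u k ∈ Y i) →
    (∀ i, ∃ u : ℕ → V, IsBlockSeq c u ∧ ∀ k, u k ∈ Z i) →
    ∃ y z : Fin n → V,
      (∀ i, y i ∈ Y i ∧ ‖y i‖ = 1) ∧ (∀ i, z i ∈ Z i ∧ ‖z i‖ = 1) ∧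
      IsBlockSeq c y ∧ IsBlockSeq c z ∧ M * (‖∑ i, y i‖ + 1) < ‖∑ i, z i‖

theorem not_equivalent {M : ℝ} {n : ℕ} {y z : Fin n → V} (h : M * ‖∑ i, y i‖ < ‖∑ i, z i‖) :
    ¬ Equivalent 𝕜 M y z := fun hyz => by
  have := (hyz fun _ => 1).2
  simp only [one_smul] at this
  exact this.not_gt h

theorem HasInhomogeneousSums.blockUniformlyInhomogeneous (h : HasInhomogeneousSums c) :
    BlockUniformlyInhomogeneous c := by
  intro M hM
  obtain ⟨n, hn⟩ := h M hM
  refine ⟨n, fun Y Z hY hZ => ?_⟩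
  obtain ⟨y, z, hy, hz, hby, hbz, hlt⟩ := hn Y Z hY hZ
  refine ⟨y, z, hy, hz, hby, hbz, not_equivalent (lt_of_le_of_lt ?_ hlt)⟩
  nlinarith

/-- An infinite-dimensional subspace contains vectors arbitrarily far out up to a small
perturbation. -/
theorem exists_far_vector (hc : IsCoordSystem c) {P : ℕ → ℕ → V →L[𝕜] V} (hP : IsProjSystem c P)
    {Y : Submodule 𝕜 V} (hY : ¬ FiniteDimensional 𝕜 Y) (p : ℕ) {η : ℝ} (hη : 0 < η) :
    ∃ (q : ℕ) (u y : V), p ≤ q ∧ ‖u‖ = 1 ∧ supp c u ⊆ Set.Ico p q ∧ y ∈ Y ∧ ‖u - y‖ ≤ η := by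
  obtain ⟨y₀, hy₀Y, hy₀, hy₀c⟩ : ∃ y ∈ Y, y ≠ 0 ∧ ∀ n < p, c n y = 0 := by
    by_contra! hcon
    refine hY (FiniteDimensional.of_injective (K := 𝕜) (V := Y) (V₂ := Fin p → 𝕜)
      ((LinearMap.pi fun n : Fin p => (hc.linear n).mk' (c n)).comp Y.subtype) ?_)
    rw [← LinearMap.ker_eq_bot, LinearMap.ker_eq_bot']
    intro y hy
    by_contra hne
    obtain ⟨n, hn, hn'⟩ := hcon y y.2 (by simpa using hne)
    exact hn' (congrFun hy ⟨n, hn⟩)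
  have hpos : 0 < ‖y₀‖ := norm_pos_iff.2 hy₀
  have hev : ∀ᶠ q in atTop, ‖P 0 q y₀ - y₀‖ < min (η / 2) (1 / 2) * ‖y₀‖ := by
    have := (tendsto_iff_norm_sub_tendsto_zero.1 (hP.tendsto y₀)).eventually
      (gt_mem_nhds (show 0 < min (η / 2) (1 / 2) * ‖y₀‖ by positivity))
    exact this
  obtain ⟨q, hq, hpq⟩ := (hev.and (eventually_ge_atTop p)).exists
  have h1 : ‖P 0 q y₀ - y₀‖ ≤ η / 2 * ‖y₀‖ :=
    hq.le.trans (by gcongr; exact min_le_left _ _)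
  have h2 : ‖P 0 q y₀ - y₀‖ ≤ 1 / 2 * ‖y₀‖ :=
    hq.le.trans (by gcongr; exact min_le_right _ _)
  set u₀ := P 0 q y₀ with hu₀
  have h3 : ‖y₀‖ / 2 ≤ ‖u₀‖ := by
    have := norm_sub_norm_le y₀ u₀
    rw [norm_sub_rev] at this
    linarith
  have h4 : 0 < ‖u₀‖ := by linarith
  refine ⟨q, (‖u₀‖ : 𝕜)⁻¹ • u₀, (‖u₀‖ : 𝕜)⁻¹ • y₀, hpq, ?_, ?_, Y.smul_mem _ hy₀Y, ?_⟩
  · rw [norm_smul, norm_inv, RCLike.norm_ofReal, abs_of_pos h4, inv_mul_cancel₀ h4.ne']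
  · intro n hn
    have hn' : c n u₀ ≠ 0 := hc.supp_smul_subset _ _ hn
    rw [hu₀, hP.coord] at hn'
    split_ifs at hn' with h
    · exact ⟨not_lt.1 fun hnp => hn' (hy₀c n hnp), h.2⟩
    · exact absurd rfl hn'
  · rw [← smul_sub, norm_smul, norm_inv, RCLike.norm_ofReal, abs_of_pos h4, inv_mul_le_iff₀ h4]
    nlinarith

/-- An infinite-dimensional subspace is up to a small perturbation spanned by a block sequence. -/
theorem exists_block_approx (hc : IsCoordSystem c) {P : ℕ → ℕ → V →L[𝕜] V}
    (hP : IsProjSystem c P) {Y : Submodule 𝕜 V} (hY : ¬ FiniteDimensional 𝕜 Y) {δ : ℝ}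
    (hδ : 0 < δ) :
    ∃ u : ℕ → V, IsBlockSeq c u ∧
      ∀ v ∈ Submodule.span 𝕜 (Set.range u), ∃ v' ∈ Y, ‖v - v'‖ ≤ δ * ‖v‖ := by
  obtain ⟨e, t, he, -, ht⟩ := exists_chain (T := V × V)
    (R := fun i p q t => ‖t.1‖ = 1 ∧ supp c t.1 ⊆ Set.Ico p q ∧ t.2 ∈ Y ∧
      ‖t.1 - t.2‖ ≤ δ / 2 * (1 / 2) ^ i)
    (fun i p => by
      obtain ⟨q, u, y, hpq, h1, h2, h3, h4⟩ :=
        exists_far_vector hc hP hY p (η := δ / 2 * (1 / 2) ^ i) (by positivity)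
      exact ⟨q, (u, y), hpq, h1, h2, h3, h4⟩) 0
  refine ⟨fun i => (t i).1, ⟨fun i h0 => ?_, fun i => ?_, fun i j hij p hp q hq => ?_⟩, ?_⟩
  · have := (ht i).1
    rw [h0, norm_zero] at this
    exact zero_ne_one this
  · exact (Set.finite_Ico _ _).subset (ht i).2.1
  · exact ((ht i).2.1 hp).2.trans_le ((he hij).trans ((ht j).2.1 hq).1)
  · intro v hv
    rw [Finsupp.mem_span_range_iff_exists_finsupp] at hv
    obtain ⟨a, rfl⟩ := hv
    have hproj : ∀ k, P (e k) (e (k + 1)) (a.sum fun i x => x • (t i).1) = a k • (t k).1 := by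
      intro k
      refine hc.eq_of_coord fun n => ?_
      rw [hP.coord, Finsupp.sum, hc.map_sum, (hc.linear n).map_smul]
      simp only [(hc.linear n).map_smul]
      split_ifs with hn
      · rw [Finset.sum_eq_single k]
        · intro i _ hik
          by_contra h
          have h' : n ∈ supp c (t i).1 := fun h0 => h (by rw [h0, smul_zero])
          have hi := (ht i).2.1 h'
          rcases lt_or_gt_of_ne hik with h1 | h1
          · have h2 := he (show i + 1 ≤ k from h1)
            have h3 := hi.2
            omega
          · have h2 := he (show k + 1 ≤ i from h1)
            have h3 := hi.1
            omega
        · intro hk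
          rw [Finsupp.notMem_support_iff.1 hk, zero_smul]
      · have : c n (t k).1 = 0 := by
          by_contra h
          exact hn ((ht k).2.1 h)
        rw [this, smul_zero]
    set v := a.sum fun i x => x • (t i).1 with hv
    have hak : ∀ k, ‖a k‖ ≤ ‖v‖ := fun k => by
      have := hP.norm_le (e k) (e (k + 1)) v
      rwa [hproj, norm_smul, (ht k).1, mul_one] at this
    refine ⟨a.sum fun i x => x • (t i).2, Y.sum_mem fun i _ => Y.smul_mem _ (ht i).2.2.1, ?_⟩
    rw [hv, Finsupp.sum, Finsupp.sum, ← Finset.sum_sub_distrib]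
    calc ‖∑ i ∈ a.support, (a i • (t i).1 - a i • (t i).2)‖
        ≤ ∑ i ∈ a.support, ‖v‖ * (δ / 2 * (1 / 2) ^ i) := by
          refine norm_sum_le_of_le _ fun i _ => ?_
          rw [← smul_sub, norm_smul]
          exact mul_le_mul (hak i) (ht i).2.2.2 (norm_nonneg _) (norm_nonneg _)
      _ = ‖v‖ * (δ / 2) * ∑ i ∈ a.support, (1 / 2 : ℝ) ^ i := by
          rw [Finset.mul_sum]
          exact Finset.sum_congr rfl fun i _ => by ring
      _ ≤ ‖v‖ * (δ / 2) * 2 := by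
          gcongr
          refine (Finset.sum_le_sum_of_subset_of_nonneg
            (t := Finset.range (a.support.sup id + 1)) ?_ fun _ _ _ => by positivity).trans
            (sum_geometric_two_le _)
          intro i hi
          exact Finset.mem_range.2 (Nat.lt_succ_of_le (Finset.le_sup (f := id) hi))
      _ = δ * ‖v‖ := by ring

theorem exists_unit_near {Y : Submodule 𝕜 V} {v v' : V} (hv : ‖v‖ = 1) (hv' : v' ∈ Y) {δ : ℝ}
    (hδ1 : δ < 1) (h : ‖v - v'‖ ≤ δ) : ∃ w ∈ Y, ‖w‖ = 1 ∧ ‖v - w‖ ≤ 2 * δ := by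
  have h1 := abs_norm_sub_norm_le v v'
  rw [hv] at h1
  have h2 := abs_le.1 (h1.trans h)
  have hpos : 0 < ‖v'‖ := by linarith
  refine ⟨(‖v'‖ : 𝕜)⁻¹ • v', Y.smul_mem _ hv', ?_, ?_⟩
  · rw [norm_smul, norm_inv, RCLike.norm_ofReal, abs_of_pos hpos, inv_mul_cancel₀ hpos.ne']
  · have h3 : v' - (‖v'‖ : 𝕜)⁻¹ • v' = ((‖v'‖ - 1 : ℝ) : 𝕜) • ((‖v'‖ : 𝕜)⁻¹ • v') := by
      have hne : (‖v'‖ : 𝕜) ≠ 0 := RCLike.ofReal_ne_zero.2 hpos.ne'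
      rw [smul_smul]
      push_cast
      rw [sub_mul, mul_inv_cancel₀ hne, one_mul, sub_smul, one_smul]
    have h4 : ‖v' - (‖v'‖ : 𝕜)⁻¹ • v'‖ ≤ δ := by
      rw [h3, norm_smul, norm_smul, norm_inv, RCLike.norm_ofReal, RCLike.norm_ofReal,
        abs_of_pos hpos, inv_mul_cancel₀ hpos.ne', mul_one, abs_sub_comm]
      exact h1.trans h
    calc ‖v - (‖v'‖ : 𝕜)⁻¹ • v'‖ = ‖(v - v') + (v' - (‖v'‖ : 𝕜)⁻¹ • v')‖ := by
          rw [sub_add_sub_cancel]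
      _ ≤ 2 * δ := (norm_add_le _ _).trans (by linarith)

theorem HasInhomogeneousSums.uniformlyInhomogeneous (h : HasInhomogeneousSums c)
    (hc : IsCoordSystem c) {P : ℕ → ℕ → V →L[𝕜] V} (hP : IsProjSystem c P) :
    UniformlyInhomogeneous 𝕜 V := by
  intro M hM
  obtain ⟨n, hn⟩ := h (2 * M) (by linarith)
  refine ⟨n, fun Y Z hY hZ => ?_⟩
  have hδ : (0 : ℝ) < 1 / (4 * (n + 1)) := by positivity
  have hδ1 : (1 : ℝ) / (4 * (n + 1)) < 1 := by
    rw [div_lt_one (by positivity)]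
    have : (0 : ℝ) ≤ n := Nat.cast_nonneg n
    linarith
  choose u hu huY using fun i => exists_block_approx hc hP (hY i) hδ
  choose w hw hwZ using fun i => exists_block_approx hc hP (hZ i) hδ
  obtain ⟨y, z, hy, hz, -, -, hlt⟩ := hn (fun i => Submodule.span 𝕜 (Set.range (u i)))
    (fun i => Submodule.span 𝕜 (Set.range (w i)))
    (fun i => ⟨u i, hu i, fun k => Submodule.subset_span ⟨k, rfl⟩⟩)
    (fun i => ⟨w i, hw i, fun k => Submodule.subset_span ⟨k, rfl⟩⟩)
  have key : ∀ {W : Fin n → Submodule 𝕜 V} {s : Fin n → ℕ → V} {v : Fin n → V},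
      (∀ i, ∀ v ∈ Submodule.span 𝕜 (Set.range (s i)), ∃ v' ∈ W i,
        ‖v - v'‖ ≤ 1 / (4 * (n + 1)) * ‖v‖) →
      (∀ i, v i ∈ Submodule.span 𝕜 (Set.range (s i)) ∧ ‖v i‖ = 1) →
      ∃ v' : Fin n → V, (∀ i, v' i ∈ W i ∧ ‖v' i‖ = 1) ∧ ‖∑ i, v i - ∑ i, v' i‖ ≤ 1 / 2 := by
    intro W s v hs hv
    have : ∀ i, ∃ v' ∈ W i, ‖v'‖ = 1 ∧ ‖v i - v'‖ ≤ 2 * (1 / (4 * (n + 1))) := fun i => by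
      obtain ⟨v', hv', hle⟩ := hs i (v i) (hv i).1
      rw [(hv i).2, mul_one] at hle
      exact exists_unit_near (hv i).2 hv' hδ1 hle
    choose v' h1 h2 h3 using this
    refine ⟨v', fun i => ⟨h1 i, h2 i⟩, ?_⟩
    rw [← Finset.sum_sub_distrib]
    refine (norm_sum_le_of_le _ fun i _ => h3 i).trans ?_
    rw [Finset.sum_const, Finset.card_univ, Fintype.card_fin, nsmul_eq_mul,
      show (n : ℝ) * (2 * (1 / (4 * (n + 1)))) = n / (2 * (n + 1)) by field_simp; ring,
      div_le_div_iff₀ (by positivity) (by norm_num)]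
    linarith
  obtain ⟨y', hy', hyy'⟩ := key huY hy
  obtain ⟨z', hz', hzz'⟩ := key hwZ hz
  refine ⟨y', z', hy', hz', not_equivalent ?_⟩
  have h1 := norm_sub_norm_le (∑ i, y' i) (∑ i, y i)
  rw [norm_sub_rev] at h1
  have h2 := norm_sub_norm_le (∑ i, z i) (∑ i, z' i)
  have h3 := norm_nonneg (∑ i, y i)
  nlinarith

end Coordinates

section Instances

variable {𝕜 X : Type*} [RCLike 𝕜] [NormedAddCommGroup X] [NormedSpace 𝕜 X]
variable (b : SchauderBasis 𝕜 X)

theorem isCoordSystem_vecCoord : IsCoordSystem (vecCoord b) :=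
  ⟨fun n => (b.coord n).toLinearMap.isLinear,
    fun _ h => eq_of_coord_eq (b := b) fun n => (h n).trans (map_zero _).symm⟩

theorem isCoordSystem_dualCoord : IsCoordSystem (dualCoord b) :=
  ⟨fun _ => ⟨fun _ _ => rfl, fun _ _ => rfl⟩, fun _ h => dual_ext (b := b) h⟩

variable {b}

theorem IsBimonotone.isProjSystem (hb : IsBimonotone b) :
    IsProjSystem (vecCoord b) (icoProj b) :=
  ⟨fun n a e v => coord_icoProj b n a e v, hb.norm_icoProj_le, tendsto_icoProj b⟩

end Instances


section Averages

variable {𝕜 X : Type*} [RCLike 𝕜] [NormedAddCommGroup X] [NormedSpace 𝕜 X]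
variable {b : SchauderBasis 𝕜 X} {f : ℝ → ℝ}

variable (b f) in
/-- Large pieces of sums of rapidly increasing sequences of length `N` are normed by forms. -/
def RISNormedByForms (N : ℕ) : Prop :=
  ∀ x : Fin N → X, IsRIS b f (1 / 10) x →
    ∀ p q : ℕ, 1 / 3 ≤ ‖intervalProj b p q (∑ i, x i)‖ →
      ‖intervalProj b p q (∑ i, x i)‖ ≤ formNorm b f (intervalProj b p q (∑ i, x i))

/-- A rapidly increasing sequence can be chosen from any supply of long averages, and it satisfies
the upper estimate. -/
theorem exists_ris (hlow : LowerEstimate b f) (hf : IsClassF f) (hb : IsBimonotone b) {N : ℕ}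
    (hN : 1 ≤ N) (hform : RISNormedByForms b f N) {Q : ℕ → ℕ → ℕ → X → Prop}
    (hQ : ∀ i A p : ℕ, ∃ (q n : ℕ) (x : X), p ≤ q ∧ A ≤ n ∧ IsL1Average b n (1 + 1 / 10) x ∧
      supp (vecCoord b) x ⊆ Set.Ico p q ∧ Q i p q x) (p₀ : ℕ) :
    ∃ (c : ℕ → ℕ) (x : ℕ → X), Monotone c ∧ c 0 = p₀ ∧
      (∀ i, ‖x i‖ = 1 ∧ supp (vecCoord b) (x i) ⊆ Set.Ico (c i) (c (i + 1)) ∧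
        Q i (c i) (c (i + 1)) (x i)) ∧
      ‖∑ i : Fin N, x i‖ ≤ 4 * (N / f N) := by
  obtain ⟨A, hA1, hA⟩ := exists_norm_sum_le (b := b) hlow hf hb hN
  obtain ⟨B, hB⟩ := exists_nat_ge (2 * (1 + 1 / 10) * growthInv f (N / min (1 / 10) 1) /
    (min (1 / 10) 1 * derivWithin f (Set.Ici 1) 1))
  have hD : ∀ p : ℕ, ∃ D : ℕ, ∀ n : ℕ, D ≤ n → (20 * p : ℝ) ^ 2 ≤ f n := fun p =>
    ((hf.tendsto_atTop.comp tendsto_natCast_atTop_atTop).eventually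
      (eventually_ge_atTop ((20 * p : ℝ) ^ 2))).exists_forall_of_atTop
  choose D hD using hD
  obtain ⟨c, t, hc, hc0, ht⟩ := exists_chain (T := ℕ × X)
    (R := fun i p q t => max (max A B) (D p) ≤ t.1 ∧ IsL1Average b t.1 (1 + 1 / 10) t.2 ∧
      supp (vecCoord b) t.2 ⊆ Set.Ico p q ∧ Q i p q t.2)
    (fun i p => by
      obtain ⟨q, n, x, h1, h2⟩ := hQ i (max (max A B) (D p)) p
      exact ⟨q, (n, x), h1, h2⟩) p₀
  refine ⟨c, fun i => (t i).2, hc, hc0,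
    fun i => ⟨(ht i).2.1.1, (ht i).2.2.1, (ht i).2.2.2⟩, ?_⟩
  have hblock : IsBlockSeq (vecCoord b) fun i : Fin N => (t i).2 := by
    refine ⟨fun i h0 => ?_, fun i => (Set.finite_Ico _ _).subset (ht i).2.2.1, ?_⟩
    · have := (ht i).2.1.1
      rw [h0, norm_zero] at this
      exact zero_ne_one this
    · exact fun i j hij p hp q hq => ((ht i).2.2.1 hp).2.trans_le
        ((hc (show (i : ℕ) + 1 ≤ j from hij)).trans ((ht j).2.2.1 hq).1)
  have hran : ∀ k : Fin N, ((ran (vecCoord b) (∑ i with i < k, (t i).2)).ncard : ℝ) ≤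
      1 / 20 * Real.sqrt (f (t k).1) := by
    intro k
    have hsub : ran (vecCoord b) (∑ i with i < k, (t i).2) ⊆ Set.Iio (c k) := by
      rintro m ⟨-, -, q, hq, -, hmq⟩
      obtain ⟨i, hi, hi'⟩ := coord_ne_zero_of_sum hq
      have hik : (i : ℕ) + 1 ≤ k := (Finset.mem_filter.1 hi).2
      exact hmq.trans_lt (((ht i).2.2.1 hi').2.trans_le (hc hik))
    have h1 : (ran (vecCoord b) (∑ i with i < k, (t i).2)).ncard ≤ c k := by
      have := Set.ncard_le_ncard hsub (Set.finite_Iio _)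
      rwa [← Finset.coe_Iio, Set.ncard_coe_finset, Nat.card_Iio] at this
    have h2 : (20 * c k : ℝ) ≤ Real.sqrt (f (t k).1) :=
      Real.le_sqrt_of_sq_le (hD _ _ ((le_max_right _ _).trans (ht k).1))
    have h3 : ((ran (vecCoord b) (∑ i with i < k, (t i).2)).ncard : ℝ) ≤ c k := by
      exact_mod_cast h1
    linarith
  have hmin : min (1 / 10 : ℝ) 1 / 2 = 1 / 20 := by
    rw [min_eq_left (by norm_num)]
    norm_num
  refine hA (fun i => (t i).2) (fun i => (t i).1) hblock
    (fun i => (le_max_left _ _).trans ((le_max_left _ _).trans (ht i).1)) (fun i => (ht i).2.1)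
    (fun k _ => hran k) (hform _ ⟨hblock, fun i => (t i).1, fun i => (ht i).2.1, fun k _ => ?_,
      fun k _ => ?_⟩)
  · refine hB.trans ?_
    exact_mod_cast (le_max_right _ _).trans ((le_max_left _ _).trans (ht k).1)
  · rw [hmin]
    exact hran k

theorem isL1Average_of_norm_ge {n : ℕ} (hn : 1 ≤ n) {v : Fin n → X}
    (hv : IsBlockSeq (vecCoord b) v) {r : ℝ} (hr : 0 < r) (hvr : ∀ j, ‖v j‖ ≤ r)
    (hsum : 10 / 11 * (n * r) ≤ ‖∑ j, v j‖) :
    IsL1Average b n (1 + 1 / 10) ((‖∑ j, v j‖ : 𝕜)⁻¹ • ∑ j, v j) := by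
  have hn0 : (0 : ℝ) < n := by exact_mod_cast hn
  have hpos : 0 < ‖∑ j, v j‖ := lt_of_lt_of_le (by positivity) hsum
  refine ⟨?_, fun j => (‖∑ j, v j‖ : 𝕜)⁻¹ • v j, hv.smul (isCoordSystem_vecCoord b) fun _ =>
    inv_ne_zero (RCLike.ofReal_ne_zero.2 hpos.ne'), fun j => ?_, Finset.smul_sum⟩
  · rw [norm_smul, norm_inv, RCLike.norm_ofReal, abs_of_pos hpos, inv_mul_cancel₀ hpos.ne']
  · rw [norm_smul, norm_inv, RCLike.norm_ofReal, abs_of_pos hpos, inv_mul_le_iff₀ hpos]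
    refine (hvr j).trans ?_
    rw [← mul_div_assoc, le_div_iff₀ hn0]
    linarith

theorem supp_smul_sum_subset {a : 𝕜} {n p q : ℕ} {v : Fin n → X}
    (hv : ∀ j, supp (vecCoord b) (v j) ⊆ Set.Ico p q) :
    supp (vecCoord b) (a • ∑ j, v j) ⊆ Set.Ico p q := by
  intro m hm
  obtain ⟨j, -, hj⟩ := coord_ne_zero_of_sum
    ((isCoordSystem_vecCoord b).supp_smul_subset _ _ hm)
  exact hv j hj

/-- Long averages exist in the span of every block sequence. -/
theorem exists_average (hlow : LowerEstimate b f) (hf : IsClassF f) {Y : Submodule 𝕜 X}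
    (hY : ∃ u : ℕ → X, IsBlockSeq (vecCoord b) u ∧ ∀ k, u k ∈ Y) {n : ℕ} (hn : 1 ≤ n) (p : ℕ) :
    ∃ (q : ℕ) (x : X), p ≤ q ∧ IsL1Average b n (1 + 1 / 10) x ∧
      supp (vecCoord b) x ⊆ Set.Ico p q ∧ x ∈ Y := by
  have hC := isCoordSystem_vecCoord b
  obtain ⟨u, hu, huY⟩ := hY
  obtain ⟨w, hw, hw1, hwY, hwp⟩ := hu.exists_normalized hC huY p
  have hn0 : (0 : ℝ) < n := by exact_mod_cast hn
  by_contra hcon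
  have key : ∀ k s, ‖∑ i ∈ Finset.range (n ^ k), w (s + i)‖ ≤ (10 / 11 * n : ℝ) ^ k := by
    intro k
    induction k with
    | zero => simp [hw1]
    | succ k ih =>
      intro s
      rw [pow_succ', sum_range_mul, pow_succ']
      by_contra! hlt
      have hr : (0 : ℝ) < (10 / 11 * n : ℝ) ^ k := by positivity
      have hblock := hw.chunk hC (K := n ^ k) (Nat.one_le_pow _ _ hn) s n
      apply hcon
      have hav := isL1Average_of_norm_ge hn hblock hr (fun j => ih _)
        (by rw [← mul_assoc]; exact hlt.le)
      obtain ⟨q, hpq, hq⟩ := exists_supp_subset (c := vecCoord b)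
        (v := ∑ j : Fin n, ∑ i ∈ Finset.range (n ^ k), w (s + j * n ^ k + i)) (by
          refine (Set.finite_iUnion hblock.finite_supp).subset fun m hm => ?_
          obtain ⟨i, -, hi⟩ := coord_ne_zero_of_sum hm
          exact Set.mem_iUnion.2 ⟨i, hi⟩) p
      refine ⟨q, _, hpq, hav, fun m hm => ?_,
        Y.smul_mem _ (Y.sum_mem fun j _ => Y.sum_mem fun i _ => hwY _)⟩
      have hm' := hC.supp_smul_subset _ _ hm
      refine ⟨?_, hq m hm'⟩
      obtain ⟨j, -, hj⟩ := coord_ne_zero_of_sum hm'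
      obtain ⟨i, -, hi⟩ := coord_ne_zero_of_sum hj
      exact hwp _ m hi
  obtain ⟨k, hk⟩ := hf.exists_pow_lt hn (C := 11 / 10) (by norm_num)
  have h1 := hlow.sum_norm_le hf (s := Finset.range (n ^ k))
    ⟨0, Finset.mem_range.2 (by positivity)⟩ (x := w)
    (fun i _ => hw.finite_supp i) (fun i _ j _ h => hw.successive i j h)
  have h2 := key k 0
  simp only [zero_add, hw1, Finset.sum_const, Finset.card_range, nsmul_eq_mul, mul_one,
    Nat.cast_pow] at h1 h2
  have hnk : (1 : ℝ) ≤ (n : ℝ) ^ k := one_le_pow₀ (by exact_mod_cast hn)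
  have hfp := hf.pos hnk
  have h3 : (n : ℝ) ^ k ≤ f ((n : ℝ) ^ k) * ((10 / 11) ^ k * (n : ℝ) ^ k) := by
    rw [← mul_pow]
    exact h1.trans (by gcongr)
  have h4 : f ((n : ℝ) ^ k) * ((10 / 11) ^ k * (n : ℝ) ^ k) <
      (11 / 10) ^ k * ((10 / 11) ^ k * (n : ℝ) ^ k) := by gcongr
  have h5 : (11 / 10 : ℝ) ^ k * ((10 / 11) ^ k * (n : ℝ) ^ k) = (n : ℝ) ^ k := by
    rw [← mul_assoc, ← mul_pow]
    norm_num
  linarith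

/-! ### Functionals -/

theorem dual_apply_eq_zero {φ : StrongDual 𝕜 X} {x : X}
    (h : ∀ n ∈ supp (dualCoord b) φ, n ∉ supp (vecCoord b) x) : φ x = 0 := by
  refine tendsto_nhds_unique ((φ.continuous.tendsto x).comp (tendsto_icoProj b x))
    (tendsto_const_nhds.congr fun q => ?_)
  simp only [Function.comp, icoProj_apply, map_sum, map_smul]
  refine (Finset.sum_eq_zero fun n _ => ?_).symm
  by_cases hn : φ (b n) = 0
  · rw [hn, smul_zero]
  · have : b.coord n x = 0 := not_not.1 (h n hn)
    rw [this, zero_smul]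

theorem exists_norming (φ : StrongDual 𝕜 X) {r : ℝ} (hr0 : 0 ≤ r) (hr : r < ‖φ‖) :
    ∃ v : X, ‖v‖ ≤ 1 ∧ r < RCLike.re (φ v) := by
  obtain ⟨v, hv, hrv⟩ := φ.exists_lt_apply_of_lt_opNorm hr
  have hpos : 0 < ‖φ v‖ := hr0.trans_lt hrv
  refine ⟨((‖φ v‖ : 𝕜)⁻¹ * (starRingEnd 𝕜) (φ v)) • v, ?_, ?_⟩
  · rw [norm_smul, norm_mul, norm_inv, RCLike.norm_ofReal, RCLike.norm_conj,
      abs_of_pos hpos, inv_mul_cancel₀ hpos.ne', one_mul]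
    exact hv.le
  · rw [map_smul, smul_eq_mul, mul_assoc, RCLike.conj_mul, ← RCLike.ofReal_inv,
      ← RCLike.ofReal_pow, ← RCLike.ofReal_mul, RCLike.ofReal_re, pow_two,
      inv_mul_cancel_left₀ hpos.ne']
    exact hrv

/-- The norm of a sum of successive functionals is bounded below by their action on successive
vectors. -/
theorem sum_re_le {ι : Type*} [Fintype ι] {φ : ι → StrongDual 𝕜 X} {x : ι → X}
    (horth : ∀ i j, i ≠ j → φ i (x j) = 0) {r : ℝ} (hr : ∀ i, r ≤ RCLike.re (φ i (x i))) :
    Fintype.card ι * r ≤ RCLike.re ((∑ i, φ i) (∑ i, x i)) := by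
  have h1 : (∑ i, φ i) (∑ i, x i) = ∑ i, φ i (x i) := by
    rw [sum_apply]
    refine Finset.sum_congr rfl fun i _ => ?_
    rw [map_sum, Finset.sum_eq_single i (fun j _ hj => horth i j hj.symm) (by simp)]
  rw [h1, map_sum, ← nsmul_eq_mul, ← Finset.card_univ, ← Finset.sum_const]
  exact Finset.sum_le_sum fun i _ => hr i

/-- If successive functionals add up like in `c₀`, then they norm an average. -/
theorem exists_dual_average_of_block (hb : IsBimonotone b) {n : ℕ} (hn : 1 ≤ n)
    {y : Fin n → StrongDual 𝕜 X} (hy : IsBlockSeq (dualCoord b) y) {r : ℝ} (hr : 0 < r)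
    (hyr : ∀ j, r ≤ ‖y j‖) (hsum : ‖∑ j, y j‖ ≤ 31 / 30 * r) {p : ℕ}
    (hp : ∀ j, ∀ m ∈ supp (dualCoord b) (y j), p ≤ m) :
    ∃ (q : ℕ) (x : X), p ≤ q ∧ IsL1Average b n (1 + 1 / 10) x ∧
      supp (vecCoord b) x ⊆ Set.Ico p q ∧
      supp (dualCoord b) ((‖∑ j, y j‖ : 𝕜)⁻¹ • ∑ j, y j) ⊆ Set.Ico p q ∧
      ‖(‖∑ j, y j‖ : 𝕜)⁻¹ • ∑ j, y j‖ = 1 ∧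
      1 / 2 ≤ RCLike.re (((‖∑ j, y j‖ : 𝕜)⁻¹ • ∑ j, y j) x) := by
  have hC := isCoordSystem_dualCoord b
  have hn0 : (0 : ℝ) < n := by exact_mod_cast hn
  have hne := fun j => hC.supp_nonempty (hy.ne_zero j)
  set lo : Fin n → ℕ := fun j => sInf (supp (dualCoord b) (y j)) with hlo
  set hi : Fin n → ℕ := fun j => sSup (supp (dualCoord b) (y j)) + 1 with hhi
  have hlom : ∀ j, lo j ∈ supp (dualCoord b) (y j) := fun j => Nat.sInf_mem (hne j)
  have hsub : ∀ j, supp (dualCoord b) (y j) ⊆ Set.Ico (lo j) (hi j) := fun j m hm =>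
    ⟨Nat.sInf_le hm, Nat.lt_succ_of_le (le_csSup (hy.finite_supp j).bddAbove hm)⟩
  have hlohi : ∀ i j, i < j → hi i ≤ lo j := fun i j hij =>
    hy.successive i j hij _ (Nat.sSup_mem (hne i) (hy.finite_supp i).bddAbove) _ (hlom j)
  have hex : ∀ j, ∃ v : X, ‖v‖ ≤ 1 ∧ 29 / 30 * r < RCLike.re (y j v) := fun j =>
    exists_norming (y j) (by positivity) (by linarith [hyr j])
  choose v' hv' hyv' using hex
  set v : Fin n → X := fun j => icoProj b (lo j) (hi j) (v' j) with hv
  have hvs : ∀ j, supp (vecCoord b) (v j) ⊆ Set.Ico (lo j) (hi j) := fun j m hm =>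
    (supp_icoProj_subset _ _ _ hm).1
  have hv1 : ∀ j, ‖v j‖ ≤ 1 := fun j => (hb.norm_icoProj_le _ _ _).trans (hv' j)
  have hyv : ∀ j, 29 / 30 * r ≤ RCLike.re (y j (v j)) := fun j => by
    have := dualProj_eq_self_iff.2 (hsub j)
    rw [show y j (v j) = dualProj b (lo j) (hi j) (y j) (v' j) from rfl, this]
    exact (hyv' j).le
  have hvblock : IsBlockSeq (vecCoord b) v := by
    refine ⟨fun j h0 => ?_, fun j => finite_supp_icoProj _ _ _, fun i j hij m hm m' hm' =>
      (hvs i hm).2.trans_le ((hlohi i j hij).trans (hvs j hm').1)⟩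
    have := hyv j
    rw [h0, map_zero, map_zero] at this
    nlinarith
  have horth : ∀ i j, i ≠ j → y i (v j) = 0 := by
    intro i j hij
    refine dual_apply_eq_zero (b := b) fun m hm hm' => ?_
    have h1 := hsub i hm
    have h2 := hvs j hm'
    rcases lt_or_gt_of_ne hij with h | h
    · have := hlohi i j h
      have h3 := h1.2
      have h4 := h2.1
      omega
    · have := hlohi j i h
      have h3 := h1.1
      have h4 := h2.2
      omega
  have hre := sum_re_le horth hyv
  rw [Fintype.card_fin] at hre
  have hle : RCLike.re ((∑ j, y j) (∑ j, v j)) ≤ ‖∑ j, y j‖ * ‖∑ j, v j‖ :=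
    (RCLike.re_le_norm _).trans (ContinuousLinearMap.le_opNorm _ _)
  have hSv : 29 / 31 * n ≤ ‖∑ j, v j‖ := by
    have : n * (29 / 30 * r) ≤ 31 / 30 * r * ‖∑ j, v j‖ := hre.trans (hle.trans (by gcongr))
    by_contra! h
    have h2 : 31 / 30 * r * ‖∑ j, v j‖ < 31 / 30 * r * (29 / 31 * n) := by gcongr
    linarith
  have hSvpos : 0 < ‖∑ j, v j‖ := lt_of_lt_of_le (by positivity) hSv
  have hSvn : ‖∑ j, v j‖ ≤ n := by
    refine (norm_sum_le_of_le _ fun j _ => hv1 j).trans ?_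
    simp
  have hSy : 0 < ‖∑ j, y j‖ := by
    by_contra! h
    have h0 : ‖∑ j, y j‖ = 0 := le_antisymm h (norm_nonneg _)
    rw [h0, zero_mul] at hle
    have : 0 < n * (29 / 30 * r) := by positivity
    linarith
  set q := max p (Finset.univ.sup hi) with hq
  have hIco : ∀ j, Set.Ico (lo j) (hi j) ⊆ Set.Ico p q := fun j =>
    Set.Ico_subset_Ico (hp j _ (hlom j))
      ((Finset.le_sup (f := hi) (Finset.mem_univ j)).trans (le_max_right _ _))
  refine ⟨q, (‖∑ j, v j‖ : 𝕜)⁻¹ • ∑ j, v j, le_max_left _ _,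
    isL1Average_of_norm_ge hn hvblock one_pos hv1 (by linarith),
    supp_smul_sum_subset fun j => (hvs j).trans (hIco j), fun m hm => ?_, ?_, ?_⟩
  · obtain ⟨j, -, hj⟩ := hC.supp_sum (hC.supp_smul_subset _ _ hm)
    exact hIco j (hsub j hj)
  · rw [norm_smul, norm_inv, RCLike.norm_ofReal, abs_of_pos hSy, inv_mul_cancel₀ hSy.ne']
  · rw [smul_apply, (∑ j, y j).map_smul, smul_smul, smul_eq_mul, ← RCLike.ofReal_inv, ← RCLike.ofReal_inv,
      ← RCLike.ofReal_mul, RCLike.re_ofReal_mul, ← mul_inv, ← div_eq_inv_mul,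
      le_div_iff₀ (by positivity)]
    have h1 : ‖∑ j, y j‖ * ‖∑ j, v j‖ ≤ 31 / 30 * r * n := by gcongr
    have h2 : 0 < r * n := by positivity
    linarith

/-- The span of every block sequence of functionals contains functionals that norm long
averages. -/
theorem exists_dual_average (hlow : LowerEstimate b f) (hf : IsClassF f) (hb : IsBimonotone b)
    {Y : Submodule 𝕜 (StrongDual 𝕜 X)}
    (hY : ∃ u : ℕ → StrongDual 𝕜 X, IsBlockSeq (dualCoord b) u ∧ ∀ k, u k ∈ Y) {n : ℕ}
    (hn : 1 ≤ n) (p : ℕ) :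
    ∃ (q : ℕ) (x : X), p ≤ q ∧ IsL1Average b n (1 + 1 / 10) x ∧
      supp (vecCoord b) x ⊆ Set.Ico p q ∧
      ∃ φ ∈ Y, ‖φ‖ = 1 ∧ supp (dualCoord b) φ ⊆ Set.Ico p q ∧ 1 / 2 ≤ RCLike.re (φ x) := by
  have hC := isCoordSystem_dualCoord b
  obtain ⟨u, hu, huY⟩ := hY
  obtain ⟨w, hw, hw1, hwY, hwp⟩ := hu.exists_normalized hC huY p
  by_contra hcon
  have key : ∀ k s, (31 / 30 : ℝ) ^ k ≤ ‖∑ i ∈ Finset.range (n ^ k), w (s + i)‖ := by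
    intro k
    induction k with
    | zero => simp [hw1]
    | succ k ih =>
      intro s
      rw [pow_succ' n, sum_range_mul, pow_succ']
      by_contra! hlt
      have hblock := hw.chunk hC (K := n ^ k) (Nat.one_le_pow _ _ hn) s n
      obtain ⟨q, x, hpq, hx, hxs, hφs, hφ1, hφx⟩ := exists_dual_average_of_block hb hn hblock
        (r := (31 / 30 : ℝ) ^ k) (by positivity) (fun j => ih _) hlt.le (p := p)
        (fun j m hm => by
          obtain ⟨i, -, hi⟩ := hC.supp_sum hm
          exact hwp _ m hi)
      exact hcon ⟨q, x, hpq, hx, hxs, _,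
        Y.smul_mem _ (Y.sum_mem fun j _ => Y.sum_mem fun i _ => hwY _), hφ1, hφs, hφx⟩
  obtain ⟨k, hk⟩ := hf.exists_pow_lt hn (C := 31 / 30) (by norm_num)
  have h1 := hlow.norm_sum_dual_le hf hb (s := Finset.range (n ^ k))
    ⟨0, Finset.mem_range.2 (by positivity)⟩ (φ := w) (B := 1)
    (fun i _ => (hw1 i).le) (fun i _ j _ h => hw.successive i j h)
  have h2 := key k 0
  simp only [zero_add, Finset.card_range, mul_one, Nat.cast_pow] at h1 h2
  linarith

end Averages


section DoubleFamilies

variable {𝕜 V : Type*} [RCLike 𝕜] {c : ℕ → V → 𝕜}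

theorem sum_lex {E : Type*} [AddCommMonoid E] {n m : ℕ} (g : Fin n → Fin m → E) :
    ∑ a : Fin n ×ₗ Fin m, g (ofLex a).1 (ofLex a).2 = ∑ i, ∑ j, g i j := by
  rw [← Fintype.sum_prod_type']
  exact Fintype.sum_equiv ofLex _ _ fun _ => rfl

theorem before_lex {n m : ℕ} {x : Fin n → Fin m → V} {e : ℕ → ℕ} (he : Monotone e)
    (hxe : ∀ i j, supp c (x i j) ⊆ Set.Ico (e i) (e (i + 1)))
    (hx : ∀ i j j', j < j' → Before c (x i j) (x i j')) (a a' : Fin n ×ₗ Fin m) (h : a < a') :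
    Before c (x (ofLex a).1 (ofLex a).2) (x (ofLex a').1 (ofLex a').2) := by
  rw [Prod.Lex.lt_iff] at h
  rcases h with h | ⟨h1, h2⟩
  · exact fun p hp q hq => (hxe _ _ hp).2.trans_le
      ((he (show ((ofLex a).1 : ℕ) + 1 ≤ (ofLex a').1 from h)).trans (hxe _ _ hq).1)
  · rw [h1]
    exact hx _ _ _ h2

theorem isBlockSeq_of_subset_Ico [NormedAddCommGroup V] {n : ℕ} {x : Fin n → V} {e : ℕ → ℕ} (he : Monotone e)
    (hx1 : ∀ i, ‖x i‖ = 1) (hxe : ∀ i : Fin n, supp c (x i) ⊆ Set.Ico (e i) (e (i + 1))) :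
    IsBlockSeq c x := by
  refine ⟨fun i h0 => ?_, fun i => (Set.finite_Ico _ _).subset (hxe i), fun i j hij p hp q hq =>
    (hxe i hp).2.trans_le ((he (show (i : ℕ) + 1 ≤ j from hij)).trans (hxe j hq).1)⟩
  have := hx1 i
  rw [h0, norm_zero] at this
  exact zero_ne_one this

end DoubleFamilies

section Main

variable {𝕜 X : Type*} [RCLike 𝕜] [NormedAddCommGroup X] [NormedSpace 𝕜 X]
variable {b : SchauderBasis 𝕜 X} {f : ℝ → ℝ}

/-- For fixed `n` there are admissible lengths `m` at which `f` hardly changes under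
multiplication by `n`. -/
theorem IsClassF.exists_length (hf : IsClassF f) {L : Set ℕ} (hL : L.Infinite) {n : ℕ}
    (hn : 1 ≤ n) :
    ∃ N ∈ L, ∃ m : ℕ, 1 ≤ m ∧ Real.log N ≤ m ∧ (m : ℝ) ≤ Real.exp N ∧
      f (n * m) ≤ 2 * f m := by
  obtain ⟨k, hk⟩ := hf.exists_pow_lt hn one_lt_two
  have hn1 : (1 : ℝ) ≤ n := by exact_mod_cast hn
  have hev : ∀ᶠ N : ℕ in atTop, (n : ℝ) ^ k * N ≤ Real.exp N := by
    have h1 := (Real.tendsto_exp_div_pow_atTop 1).comp tendsto_natCast_atTop_atTop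
    filter_upwards [h1.eventually (eventually_ge_atTop ((n : ℝ) ^ k)), eventually_gt_atTop 0]
      with N hN hN0
    have hN0' : (0 : ℝ) < N := by exact_mod_cast hN0
    simp only [Function.comp, pow_one] at hN
    rwa [le_div_iff₀ hN0'] at hN
  obtain ⟨N₀, hN₀⟩ := (hev.and (eventually_ge_atTop 1)).exists_forall_of_atTop
  obtain ⟨N, hNL, hN⟩ := hL.exists_gt N₀
  obtain ⟨hexp, hN1⟩ := hN₀ N hN.le
  have hN1' : (1 : ℝ) ≤ N := by exact_mod_cast hN1
  refine ⟨N, hNL, ?_⟩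
  by_contra! hcon
  have hgrow : ∀ j ≤ k, 2 ^ j * f N ≤ f ((n : ℝ) ^ j * N) := by
    intro j hj
    induction j with
    | zero => simp
    | succ j ih =>
      have hpow : (1 : ℝ) ≤ (n : ℝ) ^ j := one_le_pow₀ hn1
      have h1 := hcon (n ^ j * N) (Nat.one_le_iff_ne_zero.2 (by positivity)) ?_ ?_
      · push_cast at h1
        rw [← mul_assoc, ← pow_succ'] at h1
        rw [pow_succ']
        linarith [ih (by omega)]
      · push_cast
        refine (Real.log_le_self (by positivity)).trans ?_
        nlinarith
      · push_cast
        refine le_trans ?_ hexp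
        gcongr
        omega
  have h1 := hgrow k le_rfl
  have h2 := hf.submul ((n : ℝ) ^ k) N (one_le_pow₀ hn1) hN1'
  have h3 := hf.pos hN1'
  nlinarith

variable (b f) in
/-- The hypothesis on rapidly increasing sequences, for all lengths related to `L`. -/
def RISNormedAlong (L : Set ℕ) : Prop :=
  ∀ N ∈ L, ∀ n : ℕ, Real.log N ≤ n → (n : ℝ) ≤ Real.exp N → RISNormedByForms b f n

theorem RISNormedAlong.exists_large {L : Set ℕ} (h : RISNormedAlong b f L) (hL : L.Infinite)
    (hf : IsClassF f) (K : ℝ) : ∃ n : ℕ, 1 ≤ n ∧ K < f n ∧ RISNormedByForms b f n := by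
  obtain ⟨N₀, hN₀⟩ := ((hf.tendsto_atTop.comp tendsto_natCast_atTop_atTop).eventually
    (eventually_gt_atTop K)).exists_forall_of_atTop
  obtain ⟨n, hnL, hn⟩ := hL.exists_gt N₀
  refine ⟨n, by omega, hN₀ n hn.le, h n hnL n (Real.log_le_self (Nat.cast_nonneg n)) ?_⟩
  linarith [Real.add_one_le_exp (n : ℝ)]

theorem RISNormedAlong.exists_length {L : Set ℕ} (h : RISNormedAlong b f L) (hL : L.Infinite)
    (hf : IsClassF f) {n : ℕ} (hn : 1 ≤ n) :
    ∃ m : ℕ, 1 ≤ m ∧ f (n * m) ≤ 2 * f m ∧ RISNormedByForms b f m := by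
  obtain ⟨N, hN, m, hm, h1, h2, h3⟩ := hf.exists_length hL hn
  exact ⟨m, hm, h3, h N hN m h1 h2⟩

/-- Rapidly increasing sequences with prescribed subspaces. -/
theorem exists_ris_mem (hlow : LowerEstimate b f) (hf : IsClassF f) (hb : IsBimonotone b) {N : ℕ}
    (hN : 1 ≤ N) (hform : RISNormedByForms b f N) {Y : ℕ → Submodule 𝕜 X}
    (hY : ∀ i, ∃ u : ℕ → X, IsBlockSeq (vecCoord b) u ∧ ∀ k, u k ∈ Y i) (p₀ : ℕ) :
    ∃ (c : ℕ → ℕ) (x : ℕ → X), Monotone c ∧ c 0 = p₀ ∧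
      (∀ i, ‖x i‖ = 1 ∧ supp (vecCoord b) (x i) ⊆ Set.Ico (c i) (c (i + 1)) ∧ x i ∈ Y i) ∧
      ‖∑ i : Fin N, x i‖ ≤ 4 * (N / f N) :=
  exists_ris hlow hf hb hN hform (Q := fun i _ _ x => x ∈ Y i) (fun i A p => by
    obtain ⟨q, x, h1, h2⟩ := exists_average hlow hf (hY i) (Nat.le_add_left 1 A) p
    exact ⟨q, A + 1, x, h1, Nat.le_succ A, h2⟩) p₀

/-- Successive functionals with prescribed subspaces whose sum has large norm. -/
theorem exists_dual_ris_mem (hlow : LowerEstimate b f) (hf : IsClassF f) (hb : IsBimonotone b)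
    {N : ℕ} (hN : 1 ≤ N) (hform : RISNormedByForms b f N)
    {Y : ℕ → Submodule 𝕜 (StrongDual 𝕜 X)}
    (hY : ∀ i, ∃ u : ℕ → StrongDual 𝕜 X, IsBlockSeq (dualCoord b) u ∧ ∀ k, u k ∈ Y i) (p₀ : ℕ) :
    ∃ (c : ℕ → ℕ) (φ : ℕ → StrongDual 𝕜 X), Monotone c ∧ c 0 = p₀ ∧
      (∀ i, ‖φ i‖ = 1 ∧ supp (dualCoord b) (φ i) ⊆ Set.Ico (c i) (c (i + 1)) ∧ φ i ∈ Y i) ∧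
      f N / 8 ≤ ‖∑ i : Fin N, φ i‖ := by
  obtain ⟨c, x, hc, hc0, hx, hsum⟩ := exists_ris hlow hf hb hN hform
    (Q := fun i p q x => ∃ φ ∈ Y i, ‖φ‖ = 1 ∧ supp (dualCoord b) φ ⊆ Set.Ico p q ∧
      1 / 2 ≤ RCLike.re (φ x)) (fun i A p => by
    obtain ⟨q, x, h1, h2⟩ := exists_dual_average hlow hf hb (hY i) (Nat.le_add_left 1 A) p
    exact ⟨q, A + 1, x, h1, Nat.le_succ A, h2⟩) p₀
  choose φ hφY hφ1 hφs hφx using fun i => (hx i).2.2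
  refine ⟨c, φ, hc, hc0, fun i => ⟨hφ1 i, hφs i, hφY i⟩, ?_⟩
  have hre := sum_re_le (φ := fun i : Fin N => φ i) (x := fun i : Fin N => x i) (r := 1 / 2)
    (fun i j hij => dual_apply_eq_zero (b := b) fun m hm hm' => by
      have h1 := hφs i hm
      have h2 := (hx j).2.1 hm'
      rcases lt_or_gt_of_ne hij with h | h
      · exact absurd (h1.2.trans_le ((hc (show (i : ℕ) + 1 ≤ j from h)).trans h2.1)) (lt_irrefl _)
      · exact absurd (h2.2.trans_le ((hc (show (j : ℕ) + 1 ≤ i from h)).trans h1.1)) (lt_irrefl _))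
    (fun i => hφx i)
  rw [Fintype.card_fin] at hre
  have hle := (RCLike.re_le_norm ((∑ i : Fin N, φ i) (∑ i : Fin N, x i))).trans
    (ContinuousLinearMap.le_opNorm _ _)
  have hN1 : (1 : ℝ) ≤ N := by exact_mod_cast hN
  have hfN := hf.pos hN1
  have h1 : (N : ℝ) * (1 / 2) ≤ ‖∑ i : Fin N, φ i‖ * (4 * (N / f N)) :=
    hre.trans (hle.trans (by gcongr))
  rw [show ‖∑ i : Fin N, φ i‖ * (4 * (N / f N)) = N * (4 * ‖∑ i : Fin N, φ i‖ / f N) by ring] at h1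
  have h2 := le_of_mul_le_mul_left h1 (by linarith)
  rw [le_div_iff₀ hfN] at h2
  linarith

theorem hasInhomogeneousSums_vecCoord (hlow : LowerEstimate b f) (hf : IsClassF f)
    (hb : IsBimonotone b) {L : Set ℕ} (hL : L.Infinite) (hform : RISNormedAlong b f L) :
    HasInhomogeneousSums (vecCoord b) := by
  have hC := isCoordSystem_vecCoord b
  intro M hM
  obtain ⟨n, hn, hfn, hformn⟩ := hform.exists_large hL hf (40 * M)
  obtain ⟨m, hm, hfm, hformm⟩ := hform.exists_length hL hf hn
  have hn1 : (1 : ℝ) ≤ n := by exact_mod_cast hn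
  have hm1 : (1 : ℝ) ≤ m := by exact_mod_cast hm
  have hfm0 := hf.pos hm1
  refine ⟨n, fun Y Z hY hZ => ?_⟩
  obtain ⟨c, y, hc, -, hy, hysum⟩ := exists_ris_mem hlow hf hb hn hformn
    (Y := fun i => Y ⟨i % n, Nat.mod_lt i hn⟩) (fun i => hY _) 0
  obtain ⟨e, t, he, -, ht⟩ := exists_chain (T := ℕ → X)
    (R := fun i p q t => (∀ j : Fin m, ‖t j‖ = 1 ∧ supp (vecCoord b) (t j) ⊆ Set.Ico p q ∧
        t j ∈ Z ⟨i % n, Nat.mod_lt i hn⟩) ∧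
      (∀ j j' : Fin m, j < j' → Before (vecCoord b) (t j) (t j')) ∧
      ‖∑ j : Fin m, t j‖ ≤ 4 * (m / f m))
    (fun i p => by
      obtain ⟨e, t, he, he0, ht, hsum⟩ := exists_ris_mem hlow hf hb hm hformm
        (Y := fun _ => Z ⟨i % n, Nat.mod_lt i hn⟩) (fun _ => hZ _) p
      refine ⟨e m, t, he0 ▸ he (Nat.zero_le m), fun j => ⟨(ht j).1, (ht j).2.1.trans
        (Set.Ico_subset_Ico (he0 ▸ he (Nat.zero_le _)) (he j.2)), (ht j).2.2⟩, ?_, hsum⟩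
      exact fun j j' hjj p hp q hq => ((ht j).2.1 hp).2.trans_le
        ((he (show (j : ℕ) + 1 ≤ j' from hjj)).trans ((ht j').2.1 hq).1)) 0
  set a : ℕ → ℝ := fun i => ‖∑ j : Fin m, t i j‖ with ha
  have hmod : ∀ i : Fin n, (⟨(i : ℕ) % n, Nat.mod_lt i hn⟩ : Fin n) = i := fun i =>
    Fin.ext (Nat.mod_eq_of_lt i.2)
  have ha0 : ∀ i, 0 < a i := by
    intro i
    refine norm_pos_iff.2 fun h0 => ?_
    have hne : t i (⟨0, hm⟩ : Fin m) ≠ 0 := fun h => by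
      have := ((ht i).1 ⟨0, hm⟩).1
      rw [h, norm_zero] at this
      exact zero_ne_one this
    obtain ⟨k, hk⟩ := hC.supp_nonempty hne
    have hk' := hC.supp_subset_supp_sum (u := fun j : Fin m => t i j) (ht i).2.1
      (Finset.mem_univ (⟨0, hm⟩ : Fin m)) hk
    rw [h0] at hk'
    exact hk' ((hC.linear k).map_zero)
  set z : Fin n → X := fun i => ((a i : ℝ) : 𝕜)⁻¹ • ∑ j : Fin m, t i j with hz
  have hz1 : ∀ i, ‖z i‖ = 1 := fun i => by
    rw [hz, norm_smul, norm_inv, RCLike.norm_ofReal, abs_of_pos (ha0 i)]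
    exact inv_mul_cancel₀ (ha0 i).ne'
  have hzs : ∀ i : Fin n, supp (vecCoord b) (z i) ⊆ Set.Ico (e i) (e (i + 1)) := fun i =>
    supp_smul_sum_subset fun j => ((ht i).1 j).2.1
  refine ⟨fun i => y i, z, fun i => ⟨?_, (hy i).1⟩, fun i => ⟨?_, hz1 i⟩,
    isBlockSeq_of_subset_Ico hc (fun i => (hy i).1) fun i => (hy i).2.1,
    isBlockSeq_of_subset_Ico he hz1 hzs, ?_⟩
  · have := (hy i).2.2
    rwa [hmod] at this
  · refine (Z i).smul_mem _ ((Z i).sum_mem fun j _ => ?_)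
    have := ((ht i).1 j).2.2
    rwa [hmod] at this
  set x : Fin n → Fin m → X := fun i j => ((a i : ℝ) : 𝕜)⁻¹ • t i j with hx
  have hxt : ∀ i j, supp (vecCoord b) (x i j) ⊆ supp (vecCoord b) (t i j) := fun i j =>
    hC.supp_smul_subset _ _
  have hxn : ∀ i j, ‖x i j‖ = (a i)⁻¹ := fun i j => by
    rw [hx, norm_smul, norm_inv, RCLike.norm_ofReal, abs_of_pos (ha0 i), ((ht i).1 j).1, mul_one]
  have : Nonempty (Fin n ×ₗ Fin m) := ⟨toLex (⟨0, hn⟩, ⟨0, hm⟩)⟩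
  have hest := hlow.sum_norm_le hf (s := (Finset.univ : Finset (Fin n ×ₗ Fin m)))
    Finset.univ_nonempty (x := fun a => x (ofLex a).1 (ofLex a).2)
    (fun a _ => (Set.finite_Ico _ _).subset ((hxt _ _).trans ((ht _).1 _).2.1))
    (fun a _ a' _ h => before_lex he (fun i j => (hxt i j).trans ((ht i).1 j).2.1)
      (fun i j j' hjj p hp q hq => (ht i).2.1 j j' hjj p (hxt _ _ hp) q (hxt _ _ hq)) a a' h)
  rw [sum_lex (fun i j => ‖x i j‖), sum_lex x, Finset.card_univ, Fintype.card_lex,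
    Fintype.card_prod, Fintype.card_fin, Fintype.card_fin] at hest
  have hsum : ∑ i, ∑ j, x i j = ∑ i, z i :=
    Finset.sum_congr rfl fun i _ => Finset.smul_sum.symm
  have hlo : (n : ℝ) * (f m / 4) ≤ ∑ i, ∑ j, ‖x i j‖ := by
    simp only [hxn, Finset.sum_const, Finset.card_univ, Fintype.card_fin, nsmul_eq_mul]
    have : ∀ i ∈ (Finset.univ : Finset (Fin n)), f m / 4 ≤ m * (a i)⁻¹ := fun i _ => by
      rw [← div_eq_mul_inv, le_div_iff₀ (ha0 i)]
      have := (ht i).2.2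
      calc f m / 4 * a i ≤ f m / 4 * (4 * (m / f m)) := by gcongr
        _ = m := by field_simp
    simpa using Finset.sum_le_sum this
  push_cast at hest
  rw [hsum] at hest
  have h1 : (n : ℝ) * (f m / 4) ≤ 2 * f m * ‖∑ i, z i‖ :=
    hlo.trans (hest.trans (by gcongr))
  have h2 : (n : ℝ) / 8 ≤ ‖∑ i, z i‖ := by
    have : f m * (n / 8) ≤ f m * ‖∑ i, z i‖ := by linarith
    exact le_of_mul_le_mul_left this hfm0
  have hfn0 := hf.pos hn1
  have h3 : 1 ≤ (n : ℝ) / f n := (one_le_div hfn0).2 (hf.le_self hn1)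
  have h4 : M * (‖∑ i : Fin n, y i‖ + 1) ≤ M * (5 * (n / f n)) := by
    gcongr
    linarith
  refine lt_of_le_of_lt h4 (lt_of_lt_of_le ?_ h2)
  rw [show M * (5 * (n / f n)) = 5 * M * n / f n by ring, div_lt_div_iff₀ hfn0 (by norm_num)]
  nlinarith

theorem hasInhomogeneousSums_dualCoord (hlow : LowerEstimate b f) (hf : IsClassF f)
    (hb : IsBimonotone b) {L : Set ℕ} (hL : L.Infinite) (hform : RISNormedAlong b f L) :
    HasInhomogeneousSums (dualCoord b) := by
  have hC := isCoordSystem_dualCoord b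
  intro M hM
  obtain ⟨n, hn, hfn, hformn⟩ := hform.exists_large hL hf (136 * M)
  obtain ⟨m, hm, hfm, hformm⟩ := hform.exists_length hL hf hn
  have hm1 : (1 : ℝ) ≤ m := by exact_mod_cast hm
  have hfm0 := hf.pos hm1
  refine ⟨n, fun Z Y hZ hY => ?_⟩
  obtain ⟨c, y, hc, -, hy, hysum⟩ := exists_dual_ris_mem hlow hf hb hn hformn
    (Y := fun i => Y ⟨i % n, Nat.mod_lt i hn⟩) (fun i => hY _) 0
  obtain ⟨e, t, he, -, ht⟩ := exists_chain (T := ℕ → StrongDual 𝕜 X)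
    (R := fun i p q t => (∀ j : Fin m, ‖t j‖ = 1 ∧ supp (dualCoord b) (t j) ⊆ Set.Ico p q ∧
        t j ∈ Z ⟨i % n, Nat.mod_lt i hn⟩) ∧
      (∀ j j' : Fin m, j < j' → Before (dualCoord b) (t j) (t j')) ∧
      f m / 8 ≤ ‖∑ j : Fin m, t j‖)
    (fun i p => by
      obtain ⟨e, t, he, he0, ht, hsum⟩ := exists_dual_ris_mem hlow hf hb hm hformm
        (Y := fun _ => Z ⟨i % n, Nat.mod_lt i hn⟩) (fun _ => hZ _) p
      refine ⟨e m, t, he0 ▸ he (Nat.zero_le m), fun j => ⟨(ht j).1, (ht j).2.1.trans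
        (Set.Ico_subset_Ico (he0 ▸ he (Nat.zero_le _)) (he j.2)), (ht j).2.2⟩, ?_, hsum⟩
      exact fun j j' hjj p hp q hq => ((ht j).2.1 hp).2.trans_le
        ((he (show (j : ℕ) + 1 ≤ j' from hjj)).trans ((ht j').2.1 hq).1)) 0
  set a : ℕ → ℝ := fun i => ‖∑ j : Fin m, t i j‖ with ha
  have hmod : ∀ i : Fin n, (⟨(i : ℕ) % n, Nat.mod_lt i hn⟩ : Fin n) = i := fun i =>
    Fin.ext (Nat.mod_eq_of_lt i.2)
  have ha0 : ∀ i, 0 < a i := fun i => lt_of_lt_of_le (by positivity) (ht i).2.2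
  set z : Fin n → StrongDual 𝕜 X := fun i => ((a i : ℝ) : 𝕜)⁻¹ • ∑ j : Fin m, t i j with hz
  have hz1 : ∀ i, ‖z i‖ = 1 := fun i => by
    rw [hz, norm_smul, norm_inv, RCLike.norm_ofReal, abs_of_pos (ha0 i)]
    exact inv_mul_cancel₀ (ha0 i).ne'
  have hzs : ∀ i : Fin n, supp (dualCoord b) (z i) ⊆ Set.Ico (e i) (e (i + 1)) := fun i k hk => by
    obtain ⟨j, -, hj⟩ := hC.supp_sum (hC.supp_smul_subset _ _ hk)
    exact ((ht i).1 j).2.1 hj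
  refine ⟨z, fun i => y i, fun i => ⟨?_, hz1 i⟩, fun i => ⟨?_, (hy i).1⟩,
    isBlockSeq_of_subset_Ico he hz1 hzs,
    isBlockSeq_of_subset_Ico hc (fun i => (hy i).1) fun i => (hy i).2.1, ?_⟩
  · refine (Z i).smul_mem _ ((Z i).sum_mem fun j _ => ?_)
    have := ((ht i).1 j).2.2
    rwa [hmod] at this
  · have := (hy i).2.2
    rwa [hmod] at this
  set x : Fin n → Fin m → StrongDual 𝕜 X := fun i j => ((a i : ℝ) : 𝕜)⁻¹ • t i j with hx
  have hxt : ∀ i j, supp (dualCoord b) (x i j) ⊆ supp (dualCoord b) (t i j) := fun i j =>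
    hC.supp_smul_subset _ _
  have hxn : ∀ i j, ‖x i j‖ ≤ 8 / f m := fun i j => by
    rw [hx, norm_smul, norm_inv, RCLike.norm_ofReal, abs_of_pos (ha0 i), ((ht i).1 j).1, mul_one,
      inv_le_comm₀ (ha0 i) (by positivity), inv_div]
    exact (ht i).2.2
  have : Nonempty (Fin n ×ₗ Fin m) := ⟨toLex (⟨0, hn⟩, ⟨0, hm⟩)⟩
  have hest := hlow.norm_sum_dual_le hf hb (s := (Finset.univ : Finset (Fin n ×ₗ Fin m)))
    Finset.univ_nonempty (φ := fun a => x (ofLex a).1 (ofLex a).2) (fun a _ => hxn _ _)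
    (fun a _ a' _ h => before_lex he (fun i j => (hxt i j).trans ((ht i).1 j).2.1)
      (fun i j j' hjj p hp q hq => (ht i).2.1 j j' hjj p (hxt _ _ hp) q (hxt _ _ hq)) a a' h)
  rw [sum_lex x, Finset.card_univ, Fintype.card_lex,
    Fintype.card_prod, Fintype.card_fin, Fintype.card_fin] at hest
  have hsum : ∑ i, ∑ j, x i j = ∑ i, z i :=
    Finset.sum_congr rfl fun i _ => Finset.smul_sum.symm
  push_cast at hest
  rw [hsum] at hest
  have h1 : ‖∑ i, z i‖ ≤ 16 := by
    refine hest.trans ?_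
    calc f (n * m) * (8 / f m) ≤ 2 * f m * (8 / f m) := by gcongr
      _ = 16 := by field_simp; norm_num
  have h2 : M * (‖∑ i, z i‖ + 1) ≤ M * 17 := by
    gcongr
    linarith
  linarith

/-- The basis is shrinking: every functional is the norm limit of its projections. -/
theorem tendsto_dualProj (hlow : LowerEstimate b f) (hf : IsClassF f) (hb : IsBimonotone b)
    {L : Set ℕ} (hL : L.Infinite) (hform : RISNormedAlong b f L) (φ : StrongDual 𝕜 X) :
    Tendsto (fun q => dualProj b 0 q φ) atTop (𝓝 φ) := by
  have hC := isCoordSystem_vecCoord b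
  set g : ℕ → ℝ := fun p => ‖φ - dualProj b 0 p φ‖ with hg
  have htail : ∀ p x, Tendsto (fun r => icoProj b p r x) atTop (𝓝 (x - icoProj b 0 p x)) := by
    intro p x
    refine ((tendsto_icoProj b x).sub_const _).congr' ?_
    filter_upwards [eventually_ge_atTop p] with r hr
    rw [← icoProj_add_icoProj b (Nat.zero_le p) hr, add_sub_cancel_left]
  have htailn : ∀ p x, ‖x - icoProj b 0 p x‖ ≤ ‖x‖ := fun p x =>
    le_of_tendsto (htail p x).norm (Eventually.of_forall fun r => hb.norm_icoProj_le p r x)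
  have hanti : Antitone g := by
    intro p q hpq
    refine ContinuousLinearMap.opNorm_le_bound _ (norm_nonneg _) fun x => ?_
    have h1 : (φ - dualProj b 0 q φ) x = (φ - dualProj b 0 p φ) (x - icoProj b 0 q x) := by
      simp only [sub_apply, dualProj_apply, map_sub, icoProj_icoProj, max_self,
        min_eq_left hpq]
      abel
    rw [h1]
    exact (ContinuousLinearMap.le_opNorm _ _).trans (by gcongr; exact htailn q x)
  obtain ⟨κ, hκ⟩ : ∃ κ, Tendsto g atTop (𝓝 κ) := ⟨_, tendsto_atTop_ciInf hanti
    ⟨0, by rintro _ ⟨p, rfl⟩; exact norm_nonneg _⟩⟩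
  have hκle : ∀ p, κ ≤ g p := hanti.le_of_tendsto hκ
  rcases (ge_of_tendsto' hκ fun p => norm_nonneg (φ - dualProj b 0 p φ)).eq_or_lt with h0 | hκ0
  · rw [tendsto_iff_norm_sub_tendsto_zero]
    rw [← h0] at hκ
    refine hκ.congr fun p => ?_
    rw [hg, norm_sub_rev]
  exfalso
  obtain ⟨P, hP⟩ := (hκ.eventually (gt_mem_nhds (show κ < 31 / 30 * κ by linarith))).exists
  have hfar : ∀ p, P ≤ p → ∃ (q : ℕ) (v : X), p ≤ q ∧ ‖v‖ ≤ 1 ∧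
      supp (vecCoord b) v ⊆ Set.Ico p q ∧ 29 / 30 * κ ≤ RCLike.re (φ v) := by
    intro p _
    obtain ⟨x, hx1, hx⟩ := exists_norming (φ - dualProj b 0 p φ) (r := 29 / 30 * κ) (by positivity)
      (lt_of_lt_of_le (by linarith) (hκle p))
    have h1 : Tendsto (fun r => RCLike.re (φ (icoProj b p r x))) atTop
        (𝓝 (RCLike.re ((φ - dualProj b 0 p φ) x))) := by
      rw [sub_apply, dualProj_apply, ← map_sub]
      exact (RCLike.continuous_re.tendsto _).comp ((φ.continuous.tendsto _).comp (htail p x))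
    obtain ⟨q, hq, hpq⟩ := ((h1.eventually (lt_mem_nhds hx)).and (eventually_ge_atTop p)).exists
    exact ⟨q, icoProj b p q x, hpq, (hb.norm_icoProj_le _ _ _).trans hx1,
      fun m hm => (supp_icoProj_subset _ _ _ hm).1, hq.le⟩
  have hav : ∀ n : ℕ, 1 ≤ n → ∀ p : ℕ, ∃ (q : ℕ) (x : X), p ≤ q ∧
      IsL1Average b n (1 + 1 / 10) x ∧ supp (vecCoord b) x ⊆ Set.Ico p q ∧
      29 / 30 * κ ≤ RCLike.re (φ x) := by
    intro n hn p
    have hn0 : (0 : ℝ) < n := by exact_mod_cast hn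
    obtain ⟨c, v, hc, hc0, hv⟩ := exists_chain (T := X)
      (R := fun _ p q v => P ≤ p → P ≤ q ∧ ‖v‖ ≤ 1 ∧ supp (vecCoord b) v ⊆ Set.Ico p q ∧
        29 / 30 * κ ≤ RCLike.re (φ v))
      (fun _ p => by
        by_cases hp : P ≤ p
        · obtain ⟨q, v, hpq, h1, h2, h3⟩ := hfar p hp
          exact ⟨q, v, hpq, fun _ => ⟨hp.trans hpq, h1, h2, h3⟩⟩
        · exact ⟨p, 0, le_rfl, fun h => absurd h hp⟩) (max P p)
    have hPc : ∀ i, max P p ≤ c i := fun i => hc0 ▸ hc (Nat.zero_le i)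
    have hv' := fun i => (hv i ((le_max_left _ _).trans (hPc i))).2
    have hblock : IsBlockSeq (vecCoord b) fun j : Fin n => v j := by
      refine ⟨fun j h => ?_, fun j => (Set.finite_Ico _ _).subset (hv' j).2.1,
        fun i j hij m hm m' hm' => ((hv' i).2.1 hm).2.trans_le
          ((hc (show (i : ℕ) + 1 ≤ j from hij)).trans ((hv' j).2.1 hm').1)⟩
      have := (hv' j).2.2
      rw [h, map_zero, map_zero] at this
      linarith
    have hre : n * (29 / 30 * κ) ≤ RCLike.re (φ (∑ j : Fin n, v j)) := by
      rw [map_sum, map_sum]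
      simpa using Finset.sum_le_sum fun (j : Fin n) (_ : j ∈ Finset.univ) => (hv' j).2.2
    have hup : RCLike.re (φ (∑ j : Fin n, v j)) ≤ 31 / 30 * κ * ‖∑ j : Fin n, v j‖ := by
      have h1 : icoProj b 0 P (∑ j : Fin n, v j) = 0 := by
        refine hC.separating _ fun m => ?_
        by_contra hm
        obtain ⟨h2, h3⟩ := supp_icoProj_subset _ _ _ hm
        obtain ⟨j, -, hj⟩ := coord_ne_zero_of_sum h3
        have h4 := ((hv' j).2.1 hj).1
        have h5 := hPc j
        have h6 := h2.2
        have h7 := le_max_left P p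
        omega
      have h2 : φ (∑ j : Fin n, v j) = (φ - dualProj b 0 P φ) (∑ j : Fin n, v j) := by
        rw [sub_apply, dualProj_apply, h1, map_zero, sub_zero]
      rw [h2]
      refine (RCLike.re_le_norm _).trans ((ContinuousLinearMap.le_opNorm _ _).trans ?_)
      gcongr
    have hlo : 29 / 31 * n ≤ ‖∑ j : Fin n, v j‖ := by
      by_contra! h
      have : 31 / 30 * κ * ‖∑ j : Fin n, v j‖ < 31 / 30 * κ * (29 / 31 * n) := by gcongr
      linarith
    have hpos : 0 < ‖∑ j : Fin n, v j‖ := lt_of_lt_of_le (by positivity) hlo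
    have hle : ‖∑ j : Fin n, v j‖ ≤ n := by
      refine (norm_sum_le_of_le _ fun (j : Fin n) _ => (hv' j).1).trans ?_
      simp
    refine ⟨c n, (‖∑ j : Fin n, v j‖ : 𝕜)⁻¹ • ∑ j : Fin n, v j,
      (le_max_right _ _).trans (hPc n),
      isL1Average_of_norm_ge hn hblock one_pos (fun j => (hv' j).1) (by linarith),
      supp_smul_sum_subset fun j => (hv' j).2.1.trans
        (Set.Ico_subset_Ico ((le_max_right _ _).trans (hPc j)) (hc j.2)), ?_⟩
    rw [φ.map_smul, smul_eq_mul, ← RCLike.ofReal_inv, RCLike.re_ofReal_mul, ← div_eq_inv_mul,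
      le_div_iff₀ hpos]
    refine le_trans ?_ hre
    rw [mul_comm]
    gcongr
  obtain ⟨N, hN, hfN, hformN⟩ := hform.exists_large hL hf (4 * ‖φ‖ / (29 / 30 * κ))
  obtain ⟨c, x, -, -, hx, hsum⟩ := exists_ris hlow hf hb hN hformN
    (Q := fun _ _ _ x => 29 / 30 * κ ≤ RCLike.re (φ x)) (fun _ A p => by
      obtain ⟨q, x, h1, h2⟩ := hav (A + 1) (Nat.le_add_left 1 A) p
      exact ⟨q, A + 1, x, h1, Nat.le_succ A, h2⟩) 0
  have hN1 : (1 : ℝ) ≤ N := by exact_mod_cast hN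
  have hfN0 := hf.pos hN1
  have hre : N * (29 / 30 * κ) ≤ RCLike.re (φ (∑ i : Fin N, x i)) := by
    rw [map_sum, map_sum]
    simpa using Finset.sum_le_sum fun (i : Fin N) (_ : i ∈ Finset.univ) => (hx i).2.2
  have h1 : N * (29 / 30 * κ) ≤ ‖φ‖ * (4 * (N / f N)) :=
    hre.trans ((RCLike.re_le_norm _).trans ((φ.le_opNorm _).trans (by gcongr)))
  rw [show ‖φ‖ * (4 * (N / f N)) = N * (4 * ‖φ‖ / f N) by ring] at h1
  have h2 := le_of_mul_le_mul_left h1 (by linarith)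
  rw [le_div_iff₀ hfN0] at h2
  rw [div_lt_iff₀ (by positivity)] at hfN
  linarith

theorem isProjSystem_dualProj (hlow : LowerEstimate b f) (hf : IsClassF f) (hb : IsBimonotone b)
    {L : Set ℕ} (hL : L.Infinite) (hform : RISNormedAlong b f L) :
    IsProjSystem (dualCoord b) (dualProj b) :=
  ⟨dualCoord_dualProj b, hb.norm_dualProj_le, tendsto_dualProj hlow hf hb hL hform⟩

end Main

end BlockUI

theorem mainTheorem8 {𝕜 X : Type*} [RCLike 𝕜] [NormedAddCommGroup X] [NormedSpace 𝕜 X]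
    [CompleteSpace X] (b : SchauderBasis 𝕜 X) (hb : BlockUI.IsBimonotone b)
    (f : ℝ → ℝ) (hf : BlockUI.IsClassF f) (hlow : BlockUI.LowerEstimate b f)
    (L : Set ℕ) (hL : L.Infinite)
    (hRIS : ∀ N ∈ L, ∀ n : ℕ, Real.log N ≤ n → (n : ℝ) ≤ Real.exp N →
      ∀ x : Fin n → X, BlockUI.IsRIS b f (1 / 10) x →
        ∀ p q : ℕ, 1 / 3 ≤ ‖BlockUI.intervalProj b p q (∑ i, x i)‖ →
          ‖BlockUI.intervalProj b p q (∑ i, x i)‖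
            ≤ BlockUI.formNorm b f (BlockUI.intervalProj b p q (∑ i, x i))) :
    BlockUI.UniformlyInhomogeneous 𝕜 X ∧
    BlockUI.BlockUniformlyInhomogeneous (BlockUI.vecCoord b) ∧
    BlockUI.UniformlyInhomogeneous 𝕜 (StrongDual 𝕜 X) ∧
    BlockUI.BlockUniformlyInhomogeneous (BlockUI.dualCoord b) := by
  have h1 := BlockUI.hasInhomogeneousSums_vecCoord hlow hf hb hL hRIS
  have h2 := BlockUI.hasInhomogeneousSums_dualCoord hlow hf hb hL hRIS
  exact ⟨h1.uniformlyInhomogeneous (BlockUI.isCoordSystem_vecCoord b) hb.isProjSystem,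
    h1.blockUniformlyInhomogeneous,
    h2.uniformlyInhomogeneous (BlockUI.isCoordSystem_dualCoord b)
      (BlockUI.isProjSystem_dualProj hlow hf hb hL hRIS),
    h2.blockUniformlyInhomogeneous⟩
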